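/- Let $K\ge 2$ and $d\ge 1$ be integers. Let $E_{jk}$ be the matrix units of $M_K(\mathbb C)$. The Gell-Mann basis of $M_K(\mathbb C)$, $\mathrm{GM}(K)=\{M_a\}_{a\in\Lambda_K}$, consists of the identity $\mathbf I$ and the matrices $$\mathbf A_{jk}=\sqrt{\tfrac K2}\,(E_{jk}+E_{kj}),\qquad \mathbf B_{jk}=\sqrt{\tfrac K2}\,(-iE_{jk}+iE_{kj})\qquad(1\le j<k\le K),$$ $$\mathbf C_m=\sqrt{\tfrac{K}{m^2+m}}\,\Big(\sum_{k=1}^m E_{kk}-mE_{m+1,m+1}\Big)\qquad(1\le m\le K-1).$$ Every $\mathcal A\in M_K(\mathbb C)^{\otimes n}$ has a unique expansion $\mathcal A=\sum_{\alpha\in\Lambda_K^n}\widehat{\mathcal A}(\alpha)\,M_{\alpha_1}\otimes\cdots\otimes M_{\alpha_n}$, with $\widehat{\mathcal A}(\alpha)=K^{-n}\operatorname{tr}\big[(M_{\alpha_1}\otimes\cdots\otimes M_{\alpha_n})^\dagger\mathcal A\big]$. It is of degree at most $d$ if $\widehat{\mathcal A}(\alpha)=0$ whenever $|\{j: M_{\alpha_j}\ne\mathbf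 I\}|>d$. Put $\|\widehat{\mathcal A}\|_{\frac{2d}{d+1}}=\big(\sum_\alpha|\widehat{\mathcal A}(\alpha)|^{\frac{2d}{d+1}}\big)^{\frac{d+1}{2d}}$, and let $\|\mathcal A\|_{\mathrm{op}}$ be the operator norm on $(\mathbb C^K)^{\otimes n}$ with its Euclidean norm. For $\mathbb F\in\{\mathbb R,\mathbb C\}$ let $\mathrm{BH}^{\le d}_{\{\pm1\}}(\mathbb F)$ be the best constant in the Boolean cube Bohnenblust--Hille inequality for $\mathbb F$-valued functions, that is, the infimum of all real $C$ such that for all $n\ge1$ and all $f(x)=\sum_{S\subset\{1,\dots,n\},\,|S|\le d}c_S\prod_{j\in S}x_j$ with $c_S\in\mathbb F$, $$\Big(\sum_{S}|c_S|^{\frac{2d}{d+1}}\Big)^{\frac{d+1}{2d}}\le C\max_{x\in\{-1,1\}^n}|f(x)|.$$ **Theorem (Qudit Bohnenblust--Hille, Gell-Mann basis).** (i) There is a constant $C(d,K)>0$ such that for all $n\ge1$ and all Hermitian $\mathcal A\in M_K(\mathbb C)^{\otimes n}$ of degree at most $d$, $$\|\widehat{\mathcal A}\|_{\frac{2d}{d+1}}\le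 C(d,K)\,\|\mathcal A\|_{\mathrm{op}},$$ and $C(d,K)\le\big(\tfrac32(K^2-K)\big)^d\,\mathrm{BH}^{\le d}_{\{\pm1\}}(\mathbb R)<\infty$. (ii) There is a constant $C'(d,K)>0$ such that the same inequality, with $C'(d,K)$ in place of $C(d,K)$, holds for all $n\ge1$ and all (not necessarily Hermitian) $\mathcal A\in M_K(\mathbb C)^{\otimes n}$ of degree at most $d$, and $C'(d,K)\le\big(\tfrac32(K^2-K)\big)^d\,\mathrm{BH}^{\le d}_{\{\pm1\}}(\mathbb C)<\infty$. -/

import Mathlib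

namespace QuditBH

/-- Pairs `(j, k)` with `j < k`. -/
abbrev PairLT (K : ℕ) : Type := {p : Fin K × Fin K // p.1 < p.2}

/-- Index set of the Gell-Mann basis of `M_K(ℂ)`: `none` stands for the identity matrix,
followed by the labels of the symmetric, the antisymmetric and the diagonal matrices. -/
abbrev GMIndex (K : ℕ) : Type := Option ((PairLT K ⊕ PairLT K) ⊕ Fin (K - 1))

/-- The matrix `A_{jk} = √(K/2) (E_{jk} + E_{kj})`. -/
noncomputable def gmSym (K : ℕ) (p : PairLT K) : Matrix (Fin K) (Fin K) ℂ :=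
  ((Real.sqrt ((K : ℝ) / 2) : ℝ) : ℂ) •
    (Matrix.single p.1.1 p.1.2 (1 : ℂ) + Matrix.single p.1.2 p.1.1 (1 : ℂ))

/-- The matrix `B_{jk} = √(K/2) (-i E_{jk} + i E_{kj})`. -/
noncomputable def gmAnti (K : ℕ) (p : PairLT K) : Matrix (Fin K) (Fin K) ℂ :=
  ((Real.sqrt ((K : ℝ) / 2) : ℝ) : ℂ) •
    (Matrix.single p.1.1 p.1.2 (-Complex.I) + Matrix.single p.1.2 p.1.1 Complex.I)

/-- The matrix `C_m = Γ_m (∑_{k=1}^m E_{kk} - m E_{m+1,m+1})`, `Γ_m = √(K/(m²+m))`,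
for `1 ≤ m ≤ K - 1`.  Here `m = r + 1` with `r : Fin (K - 1)`, and the canonical basis of `ℂ^K`
is numbered from `0`, so that `E_{m+1,m+1}` sits at the position numbered `r + 1`. -/
noncomputable def gmDiag (K : ℕ) (r : Fin (K - 1)) : Matrix (Fin K) (Fin K) ℂ :=
  ((Real.sqrt ((K : ℝ) / (((r : ℕ) + 1 : ℝ) ^ 2 + ((r : ℕ) + 1 : ℝ))) : ℝ) : ℂ) •
    ((∑ k ∈ Finset.univ.filter (fun k : Fin K => (k : ℕ) ≤ (r : ℕ)), Matrix.single k k (1 : ℂ)) -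
      (((r : ℕ) + 1 : ℕ) : ℂ) •
        Matrix.single (⟨(r : ℕ) + 1, by have := r.isLt; omega⟩ : Fin K)
          (⟨(r : ℕ) + 1, by have := r.isLt; omega⟩ : Fin K) (1 : ℂ))

/-- The generalized Gell-Mann matrices. -/
noncomputable def gmMatrix (K : ℕ) : GMIndex K → Matrix (Fin K) (Fin K) ℂ
  | none => 1
  | some (Sum.inl (Sum.inl p)) => gmSym K p
  | some (Sum.inl (Sum.inr p)) => gmAnti K p
  | some (Sum.inr r) => gmDiag K r

/-- The algebra `M_K(ℂ)^{⊗ n}`, realized as the matrices acting on `(ℂ^K)^{⊗ n}`, whose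
canonical basis is indexed by `Fin n → Fin K`. -/
abbrev QuditOp (n K : ℕ) : Type := Matrix (Fin n → Fin K) (Fin n → Fin K) ℂ

/-- The tensor (Kronecker) product `M_0 ⊗ ⋯ ⊗ M_{n-1}`. -/
def tensorMatrix {n K : ℕ} (M : Fin n → Matrix (Fin K) (Fin K) ℂ) : QuditOp n K :=
  Matrix.of fun a b => ∏ j, M j (a j) (b j)

/-- The tensor Gell-Mann basis element `M_α = M_{α_0} ⊗ ⋯ ⊗ M_{α_{n-1}}`. -/
noncomputable def gmTensor {n K : ℕ} (α : Fin n → GMIndex K) : QuditOp n K :=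
  tensorMatrix fun j => gmMatrix K (α j)

/-- The Gell-Mann coefficient `Â(α) = K^{-n} tr (M_α† A)`.  These are the coefficients of the
unique expansion of `A` in the tensor Gell-Mann basis, see `eq_sum_gmTensor_iff`. -/
noncomputable def gmCoeff {n K : ℕ} (A : QuditOp n K) (α : Fin n → GMIndex K) : ℂ :=
  ((K : ℂ) ^ n)⁻¹ * ((gmTensor α).conjTranspose * A).trace

theorem gmDiag_eq (K : ℕ) (r : Fin (K - 1)) :
    gmDiag K r = ((Real.sqrt ((K : ℝ) / (((r : ℕ) + 1 : ℝ) ^ 2 + ((r : ℕ) + 1 : ℝ))) : ℝ) : ℂ) •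
      Matrix.diagonal (fun i : Fin K => (if (i : ℕ) ≤ r then (1 : ℂ) else 0) -
        ((r : ℕ) + 1 : ℂ) * if (i : ℕ) = r + 1 then (1 : ℂ) else 0) := by
  unfold gmDiag
  congr 1
  ext i j
  by_cases h : i = j
  · subst h
    have e : ∀ k : Fin K, (Matrix.single k k (1 : ℂ)) i i = if k = i then 1 else 0 := by
      intro k; simp [Matrix.single_apply]
    rw [Matrix.sub_apply, Matrix.smul_apply, Matrix.sum_apply, e, Matrix.diagonal_apply_eq,
      Finset.sum_congr rfl fun k _ => e k, Finset.sum_ite_eq']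
    simp [Fin.ext_iff, eq_comm]
  · have h' : ∀ x : Fin K, ¬ (x = i ∧ x = j) := fun x hx => h (hx.1.symm.trans hx.2)
    simp [Matrix.sum_apply, h, h']

theorem sum_fin_le {K m : ℕ} (hm : m < K) :
    (∑ i : Fin K, if (i : ℕ) ≤ m then (1 : ℂ) else 0) = (m : ℂ) + 1 := by
  have h := Fin.card_Iic (⟨m, hm⟩ : Fin K)
  have h2 : Finset.univ.filter (fun i : Fin K => (i : ℕ) ≤ m) = Finset.Iic (⟨m, hm⟩ : Fin K) := by
    ext i; simp [Fin.le_def]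
  rw [Finset.sum_boole, h2, h]; push_cast; rfl

theorem sum_fin_eq {K m : ℕ} (hm : m < K) :
    (∑ i : Fin K, if (i : ℕ) = m then (1 : ℂ) else 0) = 1 := by
  rw [Finset.sum_eq_single (⟨m, hm⟩ : Fin K)]
  · simp
  · intro b _ hb
    simpa [Fin.ext_iff] using hb
  · simp

theorem gm_diag_sum {K : ℕ} (r s : ℕ) (hr : r + 1 < K) (hrs : r ≤ s) :
    (∑ i : Fin K, ((if (i : ℕ) ≤ r then (1 : ℂ) else 0) -
        ((r : ℕ) + 1 : ℂ) * if (i : ℕ) = r + 1 then (1 : ℂ) else 0) *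
      ((if (i : ℕ) ≤ s then (1 : ℂ) else 0) -
        ((s : ℕ) + 1 : ℂ) * if (i : ℕ) = s + 1 then (1 : ℂ) else 0)) =
      if r = s then ((r : ℂ) + 1) ^ 2 + ((r : ℂ) + 1) else 0 := by
  have e : ∀ i : Fin K, ((if (i : ℕ) ≤ r then (1 : ℂ) else 0) -
        ((r : ℕ) + 1 : ℂ) * if (i : ℕ) = r + 1 then (1 : ℂ) else 0) *
      ((if (i : ℕ) ≤ s then (1 : ℂ) else 0) -
        ((s : ℕ) + 1 : ℂ) * if (i : ℕ) = s + 1 then (1 : ℂ) else 0) =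
      (if (i : ℕ) ≤ r then (1 : ℂ) else 0) + (if r = s then ((r : ℂ) + 1) ^ 2 else - ((r : ℂ) + 1)) *
        if (i : ℕ) = r + 1 then (1 : ℂ) else 0 := by
    intro i
    split_ifs <;> first | omega | (subst_vars; ring_nf)
  rw [Finset.sum_congr rfl fun i _ => e i, Finset.sum_add_distrib, ← Finset.mul_sum,
    sum_fin_le (by omega), sum_fin_eq hr]
  split_ifs <;> ring

theorem trace_conj_single {K : ℕ} (A : Matrix (Fin K) (Fin K) ℂ) (i j : Fin K) (c : ℂ) :
    (A.conjTranspose * Matrix.single i j c).trace = star (A i j) * c := by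
  simp [Matrix.trace_mul_single]

theorem gm_sqrt (K : ℕ) : ((Real.sqrt ((K : ℝ) / 2) : ℝ) : ℂ) * ((Real.sqrt ((K : ℝ) / 2) : ℝ) : ℂ)
    = (K : ℂ) / 2 := by
  rw [← Complex.ofReal_mul, Real.mul_self_sqrt (by positivity)]; push_cast; rfl

theorem gm_orth_off {K : ℕ} (a : GMIndex K) (b : PairLT K ⊕ PairLT K) :
    ((gmMatrix K a).conjTranspose * gmMatrix K (some (Sum.inl b))).trace =
      if a = some (Sum.inl b) then (K : ℂ) else 0 := by
  have hσ := gm_sqrt K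
  rcases b with ⟨⟨b1, b2⟩, hb⟩ | ⟨⟨b1, b2⟩, hb⟩ <;>
  rcases a with _ | ((⟨⟨a1, a2⟩, ha⟩ | ⟨⟨a1, a2⟩, ha⟩) | r) <;>
  simp only [gmMatrix, gmSym, gmAnti, gmDiag_eq, Matrix.mul_smul, Matrix.mul_add,
    Matrix.trace_smul, Matrix.trace_add, trace_conj_single] <;>
  generalize Real.sqrt ((K : ℝ) / 2) = σ at hσ ⊢
  all_goals simp only at hb
  all_goals try simp only at ha
  all_goals simp [Matrix.single_apply, hb.ne, hb.ne']
  all_goals split_ifs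
  all_goals first
    | omega
    | (simp; done)
    | (simp; linear_combination 2 * hσ)
    | (simp; linear_combination (-2 * Complex.I ^ 2) * hσ - K * Complex.I_sq)

theorem gm_orth_symm {K : ℕ} {a b : GMIndex K}
    (h : ((gmMatrix K a).conjTranspose * gmMatrix K b).trace = if a = b then (K : ℂ) else 0) :
    ((gmMatrix K b).conjTranspose * gmMatrix K a).trace = if b = a then (K : ℂ) else 0 := by
  have := congrArg star h
  rw [← Matrix.trace_conjTranspose, Matrix.conjTranspose_mul,
    Matrix.conjTranspose_conjTranspose] at this
  rw [this]
  by_cases hab : a = b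
  · simp [hab]
  · simp [hab, Ne.symm hab]

theorem gm_orth_diag {K : ℕ} (r s : Fin (K - 1)) (hrs : r ≤ s) :
    ((gmDiag K r).conjTranspose * gmDiag K s).trace = if r = s then (K : ℂ) else 0 := by
  have hr := r.isLt
  have hs := s.isLt
  have h := gm_diag_sum (K := K) r s (by omega) hrs
  rw [gmDiag_eq, gmDiag_eq, Matrix.conjTranspose_smul, Matrix.diagonal_conjTranspose,
    Matrix.smul_mul, Matrix.mul_smul, Matrix.diagonal_mul_diagonal, Matrix.trace_smul,
    Matrix.trace_smul, Matrix.trace_diagonal]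
  have e : ∀ i : Fin K, (star (fun i : Fin K => (if (i : ℕ) ≤ r then (1 : ℂ) else 0) -
        ((r : ℕ) + 1 : ℂ) * if (i : ℕ) = r + 1 then (1 : ℂ) else 0)) i =
        (if (i : ℕ) ≤ r then (1 : ℂ) else 0) -
        ((r : ℕ) + 1 : ℂ) * if (i : ℕ) = r + 1 then (1 : ℂ) else 0 := by
    intro i
    simp only [Pi.star_apply]
    split_ifs <;> simp
  rw [Finset.sum_congr rfl fun i _ => by rw [e i], h]
  by_cases hh : r = s
  · subst hh
    simp only [if_true, smul_eq_mul, Complex.star_def, Complex.conj_ofReal]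
    rw [← mul_assoc, ← Complex.ofReal_mul, Real.mul_self_sqrt (by positivity)]
    have h2 : (((r : ℕ) : ℂ) + 1) ^ 2 + (((r : ℕ) : ℂ) + 1) ≠ 0 := by
      have : (((r : ℕ) + 1) ^ 2 + ((r : ℕ) + 1) : ℕ) ≠ 0 := by positivity
      exact_mod_cast this
    push_cast
    exact div_mul_cancel₀ _ h2
  · have : (r : ℕ) ≠ s := fun h => hh (Fin.ext h)
    simp [hh, this]

/-- Orthonormality with respect to the normalized trace inner product. -/
theorem gm_orth {K : ℕ} (a b : GMIndex K) :
    ((gmMatrix K a).conjTranspose * gmMatrix K b).trace = if a = b then (K : ℂ) else 0 := by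
  have h0 : ∀ r : Fin (K - 1), (gmDiag K r).trace = 0 := by
    intro r
    have hr := r.isLt
    rw [gmDiag_eq, Matrix.trace_smul, Matrix.trace_diagonal, Finset.sum_sub_distrib,
      ← Finset.mul_sum, sum_fin_le (by omega), sum_fin_eq (by omega)]
    simp
  have h1 : ∀ r : Fin (K - 1), ((gmMatrix K none).conjTranspose *
      gmMatrix K (some (Sum.inr r))).trace = if (none : GMIndex K) = some (Sum.inr r) then (K : ℂ) else 0 := by
    intro r
    simp [gmMatrix, h0]
  rcases b with _ | b | s
  · rcases a with _ | a | r
    · simp [gmMatrix]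
    · exact gm_orth_symm (gm_orth_off _ _)
    · exact gm_orth_symm (h1 r)
  · exact gm_orth_off _ _
  · rcases a with _ | a | r
    · exact h1 s
    · exact gm_orth_symm (gm_orth_off _ _)
    · rcases le_total r s with h | h
      · simpa [gmMatrix] using gm_orth_diag r s h
      · exact gm_orth_symm (by simpa [gmMatrix] using gm_orth_diag s r h)

theorem gmTensor_orth {n K : ℕ} (α β : Fin n → GMIndex K) :
    ((gmTensor α).conjTranspose * gmTensor β).trace = if α = β then (K : ℂ) ^ n else 0 := by
  have h : ((gmTensor α).conjTranspose * gmTensor β).trace =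
      ∏ j, ((gmMatrix K (α j)).conjTranspose * gmMatrix K (β j)).trace := by
    simp only [Matrix.trace, Matrix.diag, Matrix.mul_apply, Matrix.conjTranspose_apply, gmTensor,
      tensorMatrix, Matrix.of_apply, star_prod, ← Finset.prod_mul_distrib]
    rw [Finset.prod_univ_sum, Fintype.piFinset_univ]
    refine Finset.sum_congr rfl fun a _ => ?_
    rw [Finset.prod_univ_sum, Fintype.piFinset_univ]
  rw [h]
  simp only [gm_orth]
  by_cases hab : α = β
  · simp [hab]
  · obtain ⟨j, hj⟩ := Function.ne_iff.mp hab
    rw [if_neg hab]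
    exact Finset.prod_eq_zero (Finset.mem_univ j) (by simp [hj])

theorem gmCoeff_sum {n K : ℕ} (hK : K ≠ 0) (c : (Fin n → GMIndex K) → ℂ) :
    gmCoeff (∑ β, c β • gmTensor β) = c := by
  funext α
  have hK' : (K : ℂ) ≠ 0 := by exact_mod_cast hK
  simp [gmCoeff, Matrix.mul_sum, Matrix.trace_sum, gmTensor_orth]
  field_simp

theorem card_gmIndex {K : ℕ} (hK : K ≠ 0) : Fintype.card (GMIndex K) = K ^ 2 := by
  have h1 : Fintype.card (PairLT K) = Fintype.card {p : Fin K × Fin K // p.2 < p.1} :=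
    Fintype.card_congr ((Equiv.prodComm _ _).subtypeEquiv fun p => Iff.rfl)
  have h2 : Fintype.card {p : Fin K × Fin K // p.1 = p.2} = K := by
    rw [Fintype.card_congr (β := Fin K) ⟨fun p => p.1.1, fun i => ⟨(i, i), rfl⟩, fun p =>
      Subtype.ext (Prod.ext rfl p.2), fun i => rfl⟩, Fintype.card_fin]
  have h3 : Fintype.card (PairLT K) + Fintype.card {p : Fin K × Fin K // p.2 < p.1} +
      Fintype.card {p : Fin K × Fin K // p.1 = p.2} = K ^ 2 := by
    simp only [Fintype.card_subtype, Finset.card_filter, ← Finset.sum_add_distrib]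
    have : ∀ p : Fin K × Fin K, ((if p.1 < p.2 then 1 else 0) + if p.2 < p.1 then 1 else 0) +
        (if p.1 = p.2 then 1 else 0) = 1 := by
      intro p
      rcases lt_trichotomy p.1 p.2 with h | h | h
      · simp [h, h.le, h.ne]
      · simp [h]
      · simp [h, h.le, h.ne']
    rw [Finset.sum_congr rfl fun p _ => this p]
    simp [sq]
  simp only [Fintype.card_option, Fintype.card_sum, Fintype.card_fin]
  omega

/-- The tensor Gell-Mann matrices form a basis of `M_K(ℂ)^{⊗ n}`, and `gmCoeff` gives the
coefficients with respect to it. -/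
theorem eq_sum_gmTensor_iff {n K : ℕ} (hK : K ≠ 0) (A : QuditOp n K)
    (c : (Fin n → GMIndex K) → ℂ) : A = ∑ α, c α • gmTensor α ↔ c = gmCoeff A := by
  have hli : LinearIndependent ℂ (gmTensor : (Fin n → GMIndex K) → QuditOp n K) := by
    rw [Fintype.linearIndependent_iff]
    intro g hg i
    have := gmCoeff_sum hK g
    rw [hg] at this
    rw [← this]
    simp [gmCoeff]
  have hspan := hli.span_eq_top_of_card_eq_finrank' (by
    simp [Module.finrank_matrix, card_gmIndex hK, -Fintype.card_option]
    ring)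
  constructor
  · rintro rfl
    exact (gmCoeff_sum hK c).symm
  · rintro rfl
    have hA : A ∈ Submodule.span ℂ (Set.range (gmTensor : (Fin n → GMIndex K) → QuditOp n K)) := by
      rw [hspan]; trivial
    obtain ⟨c, hc⟩ := (Submodule.mem_span_range_iff_exists_fun ℂ).mp hA
    rw [← hc, gmCoeff_sum hK]

/-- `|α|`, the number of tensor factors of `M_α` different from the identity. -/
def gmWeight {n K : ℕ} (α : Fin n → GMIndex K) : ℕ :=
  (Finset.univ.filter fun j => α j ≠ none).card

/-- `A` is of degree at most `d` in the tensor Gell-Mann basis. -/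
def GMDegreeLE {n K : ℕ} (d : ℕ) (A : QuditOp n K) : Prop :=
  ∀ α : Fin n → GMIndex K, d < gmWeight α → gmCoeff A α = 0

/-- The operator norm with respect to the Euclidean norm on `(ℂ^K)^{⊗ n}`. -/
noncomputable def opNorm {n K : ℕ} (A : QuditOp n K) : ℝ :=
  ‖Matrix.toEuclideanCLM (n := Fin n → Fin K) (𝕜 := ℂ) A‖

/-- The `ℓ^{2d/(d+1)}`-norm of a finite family of scalars. -/
noncomputable def bhNorm {ι 𝕜 : Type*} [Fintype ι] [RCLike 𝕜] (d : ℕ) (c : ι → 𝕜) : ℝ :=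
  (∑ i, ‖c i‖ ^ (2 * (d : ℝ) / ((d : ℝ) + 1))) ^ (((d : ℝ) + 1) / (2 * (d : ℝ)))

/-- The function `∑_S c_S ∏_{j ∈ S} x_j` on the Boolean cube `{-1,1}^n`, where `ℤˣ = {1, -1}`. -/
def cubePoly {𝕜 : Type*} [RCLike 𝕜] {n : ℕ} (c : Finset (Fin n) → 𝕜) (x : Fin n → ℤˣ) : 𝕜 :=
  ∑ S : Finset (Fin n), c S * ∏ j ∈ S, (((x j : ℤˣ) : ℤ) : 𝕜)

/-- `C` is admissible in the Boolean cube Bohnenblust--Hille inequality for functions of degree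
at most `d` with values in `𝕜 = ℝ` or `ℂ`, in every dimension. -/
def IsCubeBHConst (𝕜 : Type*) [RCLike 𝕜] (d : ℕ) (C : ℝ) : Prop :=
  ∀ n : ℕ, 1 ≤ n → ∀ c : Finset (Fin n) → 𝕜, (∀ S, d < S.card → c S = 0) →
    bhNorm d c ≤ C * ⨆ x : Fin n → ℤˣ, ‖cubePoly c x‖

/-- The best constant `BH^{≤ d}_{±1}` in the Boolean cube Bohnenblust--Hille inequality, for
functions with values in `𝕜 = ℝ` or `ℂ`. -/
noncomputable def cubeBH (𝕜 : Type*) [RCLike 𝕜] (d : ℕ) : ℝ :=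
  sInf {C : ℝ | IsCubeBHConst 𝕜 d C}

end QuditBH

namespace QuditBH

open scoped BigOperators ComplexOrder MatrixOrder
open Finset

/-! On one site, attach a sign `x_a` to every non-identity Gell-Mann label and put `ρ(x) = K⁻¹ (I +
c ∑ x_a M_a)`. With `c⁻¹ = 3 (K - 1) √(K/2)`, the symmetric, antisymmetric and diagonal sums are
each absorbed by one third of the identity, so `ρ(x)` is a state for every choice of signs
(`posSemidef_one_add_smul_sum`). Testing `A` against products of these states gives, by
orthogonality of the basis, `∑_α Â(α) c^|α| ∏ x`, a function on the cube with `n (K² - 1)` bits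
(`trace_tensorMatrix_gmState_mul`). It has degree at most `d`, distinct `α` give distinct monomials,
and it is bounded by the operator norm of `A`, since a state pairs with `A` to at most that norm.
The cube inequality bounds the coefficients `Â(α) c^|α|`; removing `c^|α|` costs at most `(3/2 (K² -
K))^d`, because `√(K/2) ≤ K/2`. For Hermitian `A` the coefficients are real, so the real constant
suffices.

The cube constant is an infimum, so some admissible constant must also be exhibited. Let `|f| ≤ M`
on the cube. Scaling a group of variables by `s` and differentiating at `s = 1` bounds the sum over
`j` of the absolute odd parts of `f`, pointwise, by a multiple of `M` (`exists_sum_abs_oddPart_le`).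
Bonami's inequality compares `L²` with `L¹`, so the `ℓ²` norms of the coefficients over `{S ∋ j}`
have sum over `j` at most a multiple of `M`. A Blei-type inequality
(`sum_rpow_le_of_sum_sqrt_le_one`) turns this mixed norm into the `2d/(d+1)` norm. -/

/-! ### Walsh expansions and moment comparison on the cube. -/

/-- The Walsh function `x ↦ ∏_{j ∈ S} x_j` on the cube `{-1,1}^ι`. -/
def walsh {ι : Type*} (S : Finset ι) (x : ι → ℤˣ) : ℝ := ∏ j ∈ S, (((x j : ℤˣ) : ℤ) : ℝ)

/-- The function on the cube with Walsh coefficients `c`. -/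
def walshSum {ι : Type*} [Fintype ι] (c : Finset ι → ℝ) (x : ι → ℤˣ) : ℝ :=
  ∑ S : Finset ι, c S * walsh S x

/-- Flip the sign of the `j`-th coordinate. -/
def flipAt {ι : Type*} [DecidableEq ι] (j : ι) (x : ι → ℤˣ) : ι → ℤˣ :=
  Function.update x j (-x j)

theorem unit_sq (u : ℤˣ) : ((u : ℤ) : ℝ) * ((u : ℤ) : ℝ) = 1 := by
  rcases Int.units_eq_one_or u with h | h <;> simp [h]

theorem flipAt_flipAt {ι : Type*} [DecidableEq ι] (j : ι) (x : ι → ℤˣ) : flipAt j (flipAt j x) = x := by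
  simp [flipAt]

theorem walsh_flipAt_of_notMem {ι : Type*} [DecidableEq ι] {j : ι} {S : Finset ι} (h : j ∉ S) (x : ι → ℤˣ) :
    walsh S (flipAt j x) = walsh S x := by
  refine prod_congr rfl fun i hi => ?_
  have : i ≠ j := by rintro rfl; exact h hi
  simp [flipAt, this]

theorem walsh_insert {ι : Type*} [DecidableEq ι] {j : ι} {S : Finset ι} (h : j ∉ S) (x : ι → ℤˣ) :
    walsh (insert j S) x = ((x j : ℤ) : ℝ) * walsh S x := prod_insert h

theorem walsh_flipAt_of_mem {ι : Type*} [DecidableEq ι] {j : ι} {S : Finset ι} (h : j ∈ S) (x : ι → ℤˣ) :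
    walsh S (flipAt j x) = -walsh S x := by
  rw [← insert_erase h, walsh_insert (notMem_erase j S), walsh_insert (notMem_erase j S),
    walsh_flipAt_of_notMem (notMem_erase j S)]
  simp [flipAt]

theorem walsh_mul_self {ι : Type*} (S : Finset ι) (x : ι → ℤˣ) : walsh S x * walsh S x = 1 := by
  rw [walsh, ← prod_mul_distrib]
  exact prod_eq_one fun j _ => unit_sq _

section Cube

variable {ι : Type*} [Fintype ι] [DecidableEq ι]

/-- Functions that are odd in one coordinate have mean zero. -/
theorem expect_eq_zero_of_flipAt {g : (ι → ℤˣ) → ℝ} (j : ι) (hg : ∀ x, g (flipAt j x) = -g x) :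
    𝔼 x, g x = 0 := by
  have h : 𝔼 x, g x = 𝔼 x, -g x :=
    Fintype.expect_equiv ⟨flipAt j, flipAt j, flipAt_flipAt j, flipAt_flipAt j⟩ _ _
      fun x => by simp [hg]
  rw [expect_neg_distrib] at h
  linarith

theorem expect_walsh {S : Finset ι} (hS : S.Nonempty) : 𝔼 x, walsh S x = 0 := by
  obtain ⟨j, hj⟩ := hS
  exact expect_eq_zero_of_flipAt j fun x => walsh_flipAt_of_mem hj x

theorem expect_walsh_mul_walsh (S T : Finset ι) :
    𝔼 x, walsh S x * walsh T x = if S = T then 1 else 0 := by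
  split_ifs with h
  · subst h; simp [walsh_mul_self]
  · have : ∃ j, ¬(j ∈ S ↔ j ∈ T) := by
      by_contra! h'
      exact h (ext h')
    obtain ⟨j, hj⟩ := this
    refine expect_eq_zero_of_flipAt j fun x => ?_
    by_cases hS : j ∈ S
    · rw [walsh_flipAt_of_mem hS, walsh_flipAt_of_notMem (by tauto), neg_mul]
    · rw [walsh_flipAt_of_notMem hS, walsh_flipAt_of_mem (by tauto), mul_neg]

/-- Parseval's identity on the cube. -/
theorem expect_walshSum_sq (c : Finset ι → ℝ) : 𝔼 x, walshSum c x ^ 2 = ∑ S, c S ^ 2 := by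
  have h : ∀ x : ι → ℤˣ, walshSum c x ^ 2 =
      ∑ S, ∑ T, c S * c T * (walsh S x * walsh T x) := by
    intro x
    rw [walshSum, sq, sum_mul_sum]
    exact sum_congr rfl fun S _ => sum_congr rfl fun T _ => by ring
  simp only [h, expect_sum_comm, ← mul_expect, expect_walsh_mul_walsh]
  exact sum_congr rfl fun S _ => by simp [sq]

theorem expect_walshSum (c : Finset ι → ℝ) : 𝔼 x, walshSum c x = c ∅ := by
  simp only [walshSum, expect_sum_comm, ← mul_expect]
  rw [sum_eq_single ∅]
  · simp [walsh]
  · intro S _ hS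
    rw [expect_walsh (nonempty_iff_ne_empty.mpr hS), mul_zero]
  · simp

/-- Sets containing `j` are matched with the same sets without `j`, so neither of the two sums on
the right depends on `x j`. -/
theorem walshSum_eq_add (c : Finset ι → ℝ) (j : ι) (x : ι → ℤˣ) :
    walshSum c x = walshSum (fun S => if j ∈ S then 0 else c S) x +
      ((x j : ℤ) : ℝ) * walshSum (fun S => if j ∈ S then 0 else c (insert j S)) x := by
  have h1 : walshSum c x = walshSum (fun S => if j ∈ S then 0 else c S) x +
      ∑ S ∈ univ.filter (fun S : Finset ι => j ∈ S), c S * walsh S x := by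
    rw [walshSum, walshSum, sum_filter, ← sum_add_distrib]
    refine sum_congr rfl fun S _ => ?_
    split_ifs <;> simp
  have h2 : ∑ S ∈ univ.filter (fun S : Finset ι => j ∈ S), c S * walsh S x =
      ∑ S ∈ univ.filter (fun S : Finset ι => j ∉ S), c (insert j S) * walsh (insert j S) x := by
    refine sum_nbij' (fun S => S.erase j) (fun S => insert j S) ?_ ?_ ?_ ?_ ?_
    · intro S; simp
    · intro S; simp
    · intro S hS; exact insert_erase (by simpa using hS)
    · intro S hS; exact erase_insert (by simpa using hS)
    · intro S hS; rw [insert_erase (by simpa using hS)]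
  rw [h1, h2, walshSum, walshSum, mul_sum, sum_filter]
  congr 1
  refine sum_congr rfl fun S _ => ?_
  by_cases h : j ∈ S
  · simp [h]
  · simp only [h, not_false_eq_true, if_true, if_false, walsh_insert h]
    ring

theorem walshSum_flipAt {c : Finset ι → ℝ} {j : ι} (h : ∀ S, j ∈ S → c S = 0) (x : ι → ℤˣ) :
    walshSum c (flipAt j x) = walshSum c x := by
  refine sum_congr rfl fun S _ => ?_
  by_cases hS : j ∈ S
  · simp [h S hS]
  · rw [walsh_flipAt_of_notMem hS]

/-- Bonami's inequality between the fourth and the second moment. -/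
theorem expect_walshSum_pow_four_le (s : Finset ι) : ∀ (d : ℕ) (c : Finset ι → ℝ),
    (∀ S, c S ≠ 0 → S ⊆ s ∧ S.card ≤ d) →
    𝔼 x, walshSum c x ^ 4 ≤ 9 ^ d * (𝔼 x, walshSum c x ^ 2) ^ 2 := by
  induction s using Finset.induction_on with
  | empty =>
    intro d c hc
    have h : ∀ x, walshSum c x = c ∅ := by
      intro x
      rw [walshSum, sum_eq_single ∅]
      · simp [walsh]
      · intro S _ hS
        have : c S = 0 := by
          by_contra h
          exact hS (subset_empty.mp (hc S h).1)
        simp [this]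
      · simp
    simp only [h, Fintype.expect_const]
    have : (1 : ℝ) ≤ 9 ^ d := one_le_pow₀ (by norm_num)
    nlinarith [sq_nonneg (c ∅ ^ 2)]
  | insert j s hj ih =>
    intro d c hc
    -- In degree 0 no degree is left to lose to `x j`; only the empty set carries a coefficient, so
    -- the smaller `s` already suffices.
    rcases d with _ | d
    · refine ih 0 c fun S hS => ?_
      have := (hc S hS).2
      have h0 : S = ∅ := card_eq_zero.mp (by omega)
      simp [h0]
    -- The function is `f + x_j g` with `f`, `g` independent of `x_j` and `g` of degree one lower.
    -- Odd powers of `x_j` average to zero, which gives `e2` and `e4`.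
    set f : (ι → ℤˣ) → ℝ := walshSum (fun S => if j ∈ S then 0 else c S) with hf
    set g : (ι → ℤˣ) → ℝ := walshSum (fun S => if j ∈ S then 0 else c (insert j S)) with hg
    have hff : ∀ x, f (flipAt j x) = f x := walshSum_flipAt fun S hS => by simp [hS]
    have hgf : ∀ x, g (flipAt j x) = g x := walshSum_flipAt fun S hS => by simp [hS]
    have hx : ∀ x : ι → ℤˣ, (((flipAt j x j : ℤˣ) : ℤ) : ℝ) = -((x j : ℤ) : ℝ) := by
      intro x; simp [flipAt]
    have IHf : 𝔼 x, f x ^ 4 ≤ 9 ^ (d + 1) * (𝔼 x, f x ^ 2) ^ 2 := by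
      refine ih (d + 1) _ fun S hS => ?_
      by_cases h : j ∈ S
      · simp [h] at hS
      · simp only [h, if_false] at hS
        exact ⟨(subset_insert_iff_of_notMem h).mp (hc S hS).1, (hc S hS).2⟩
    have IHg : 𝔼 x, g x ^ 4 ≤ 9 ^ d * (𝔼 x, g x ^ 2) ^ 2 := by
      refine ih d _ fun S hS => ?_
      by_cases h : j ∈ S
      · simp [h] at hS
      · simp only [h, if_false] at hS
        have := hc _ hS
        rw [card_insert_of_notMem h] at this
        exact ⟨(insert_subset_insert_iff h).mp this.1, by omega⟩
    have e2 : 𝔼 x, walshSum c x ^ 2 = 𝔼 x, f x ^ 2 + 𝔼 x, g x ^ 2 := by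
      have h0 : 𝔼 x : ι → ℤˣ, 2 * (f x * g x * ((x j : ℤ) : ℝ)) = 0 :=
        expect_eq_zero_of_flipAt j fun x => by rw [hff, hgf, hx]; ring
      rw [← add_zero (𝔼 x, f x ^ 2 + 𝔼 x, g x ^ 2), ← h0, ← expect_add_distrib,
        ← expect_add_distrib]
      refine expect_congr rfl fun x _ => ?_
      rw [walshSum_eq_add c j x]
      linear_combination g x ^ 2 * unit_sq (x j)
    have e4 : 𝔼 x, walshSum c x ^ 4 =
        𝔼 x, f x ^ 4 + 6 * 𝔼 x, f x ^ 2 * g x ^ 2 + 𝔼 x, g x ^ 4 := by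
      have h0 : 𝔼 x : ι → ℤˣ, (4 * f x ^ 3 * g x + 4 * f x * g x ^ 3) * ((x j : ℤ) : ℝ) = 0 :=
        expect_eq_zero_of_flipAt j fun x => by rw [hff, hgf, hx]; ring
      rw [mul_expect, ← add_zero (_ + _ + 𝔼 x, g x ^ 4), ← h0, ← expect_add_distrib,
        ← expect_add_distrib, ← expect_add_distrib]
      refine expect_congr rfl fun x _ => ?_
      rw [walshSum_eq_add c j x]
      have hu := unit_sq (x j)
      change (f x + ((x j : ℤ) : ℝ) * g x) ^ 4 = _
      generalize ((x j : ℤ) : ℝ) = u at hu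
      linear_combination (6 * f x ^ 2 * g x ^ 2 + 4 * f x * g x ^ 3 * u +
        g x ^ 4 * (u * u + 1)) * hu
    have hcs : (𝔼 x, f x ^ 2 * g x ^ 2) ^ 2 ≤ (𝔼 x, f x ^ 4) * 𝔼 x, g x ^ 4 := by
      have := expect_mul_sq_le_sq_mul_sq univ (fun x => f x ^ 2) (fun x => g x ^ 2)
      simpa only [← pow_mul] using this
    have hf0 : 0 ≤ 𝔼 x, f x ^ 2 := expect_nonneg fun x _ => sq_nonneg _
    have hg0 : 0 ≤ 𝔼 x, g x ^ 2 := expect_nonneg fun x _ => sq_nonneg _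
    have hg4 : 0 ≤ 𝔼 x, g x ^ 4 := expect_nonneg fun x _ => by positivity
    rw [e2, e4]
    generalize 𝔼 x, f x ^ 2 = a at *
    generalize 𝔼 x, g x ^ 2 = b at *
    -- Here `9^(d+1) * 9^d = (3 * 9^d)^2`, and `6 * 3 * 9^d = 2 * 9^(d+1)` is exactly the cross term
    -- of `9^(d+1) * (a + b)^2`.
    have hmix : 𝔼 x, f x ^ 2 * g x ^ 2 ≤ 3 * 9 ^ d * a * b := by
      refine abs_le_of_sq_le_sq' (hcs.trans ?_) (by positivity) |>.2
      calc _ ≤ (9 ^ (d + 1) * a ^ 2) * (9 ^ d * b ^ 2) := by gcongr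
        _ = _ := by ring
    have h9 : (0 : ℝ) ≤ 9 ^ d * b ^ 2 := by positivity
    rw [pow_succ] at IHf ⊢
    nlinarith

/-- Comparison of the second and the first absolute moment of functions of bounded degree. -/
theorem expect_walshSum_sq_le {d : ℕ} {c : Finset ι → ℝ} (hc : ∀ S, d < S.card → c S = 0) :
    𝔼 x, walshSum c x ^ 2 ≤ 9 ^ d * (𝔼 x, |walshSum c x|) ^ 2 := by
  have h4 := expect_walshSum_pow_four_le univ d c fun S hS =>
    ⟨subset_univ S, by by_contra! h; exact hS (hc S h)⟩
  set f := walshSum c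
  -- Two Cauchy–Schwarz steps interpolate the second moment between the first and the fourth. With
  -- the fourth-moment bound they give `a^4 ≤ b^2 * a * 9^d * a^2`.
  have h1 : (𝔼 x, f x ^ 2) ^ 2 ≤ (𝔼 x, |f x|) * 𝔼 x, |f x| ^ 3 := by
    have := expect_mul_sq_le_sq_mul_sq univ (fun x => √|f x|) (fun x => √|f x| ^ 3)
    have e : ∀ x, √|f x| ^ 2 = |f x| := fun x => Real.sq_sqrt (abs_nonneg _)
    have e1 : ∀ x, √|f x| * √|f x| ^ 3 = f x ^ 2 := fun x => by
      rw [← sq_abs (f x)]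
      linear_combination (√|f x| ^ 2 + |f x|) * e x
    have e2 : ∀ x, (√|f x| ^ 3) ^ 2 = |f x| ^ 3 := fun x => by
      rw [← pow_mul, mul_comm, pow_mul, e]
    simpa only [e, e1, e2] using this
  have h2 : (𝔼 x, |f x| ^ 3) ^ 2 ≤ (𝔼 x, f x ^ 2) * 𝔼 x, f x ^ 4 := by
    have := expect_mul_sq_le_sq_mul_sq univ (fun x => |f x|) (fun x => |f x| ^ 2)
    have e1 : ∀ x, |f x| * |f x| ^ 2 = |f x| ^ 3 := fun x => by ring
    have e2 : ∀ x, (|f x| ^ 2) ^ 2 = f x ^ 4 := fun x => by rw [sq_abs]; ring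
    simp only [e1, e2] at this
    simpa only [sq_abs] using this
  have ha : 0 ≤ 𝔼 x, f x ^ 2 := expect_nonneg fun x _ => sq_nonneg _
  have hb : 0 ≤ 𝔼 x, |f x| := expect_nonneg fun x _ => abs_nonneg _
  generalize 𝔼 x, f x ^ 2 = a at *
  generalize 𝔼 x, |f x| = b at *
  rcases ha.eq_or_lt with rfl | ha
  · positivity
  have h3 : a ^ 3 * a ≤ a ^ 3 * (9 ^ d * b ^ 2) := by
    calc a ^ 3 * a = (a ^ 2) ^ 2 := by ring
      _ ≤ (b * 𝔼 x, |f x| ^ 3) ^ 2 := by gcongr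
      _ = b ^ 2 * (𝔼 x, |f x| ^ 3) ^ 2 := by ring
      _ ≤ b ^ 2 * (a * (9 ^ d * a ^ 2)) := by gcongr; exact h2.trans (by gcongr)
      _ = _ := by ring
  exact le_of_mul_le_mul_left h3 (by positivity)

end Cube

/-! ### Derivative bounds in bounded degree and Blei's inequality. -/

/-- Functionals on polynomials of bounded degree are bounded by the maximum over `[-1,1]`: the case
of the derivative at `1`. -/
theorem exists_bound_derivative_eval_one (d : ℕ) : ∃ C : ℝ, 0 ≤ C ∧ ∀ (q : Polynomial ℝ) (M : ℝ),
    q.natDegree ≤ d → (∀ s : ℝ, |s| ≤ 1 → |q.eval s| ≤ M) → |q.derivative.eval 1| ≤ C * M := by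
  -- Any `d + 1` distinct nodes in `[-1, 1]` would do: interpolation expresses the derivative at 1
  -- through the values there.
  set v : ℕ → ℝ := fun i => 1 / ((i : ℝ) + 1)
  have hv : Set.InjOn v (range (d + 1)) := by
    intro i _ k _ h
    simpa [v] using h
  refine ⟨∑ i ∈ range (d + 1), |(Lagrange.basis (range (d + 1)) v i).derivative.eval 1|,
    sum_nonneg fun _ _ => abs_nonneg _, fun q M hq hM => ?_⟩
  have hdeg : q.degree < (range (d + 1)).card := by
    rw [card_range]
    exact lt_of_le_of_lt Polynomial.degree_le_natDegree (by exact_mod_cast Nat.lt_succ_of_le hq)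
  have h := Lagrange.eq_interpolate hv hdeg
  rw [Lagrange.interpolate_apply] at h
  rw [h, Polynomial.derivative_sum, Polynomial.eval_finsetSum, sum_mul]
  refine (abs_sum_le_sum_abs _ _).trans (sum_le_sum fun i _ => ?_)
  rw [Polynomial.derivative_C_mul, Polynomial.eval_mul, Polynomial.eval_C, abs_mul, mul_comm]
  refine mul_le_mul_of_nonneg_left (hM _ ?_) (abs_nonneg _)
  rw [abs_of_nonneg (by positivity)]
  exact (div_le_one (by positivity)).mpr (by linarith [Nat.cast_nonneg (α := ℝ) i])

/-- Pointwise form of Blei's inequality. -/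
theorem rpow_le_sum_add_prod {ι : Type*} {d : ℕ} {b : ℝ} (hb : 0 ≤ b) (hb1 : b ≤ 1) {S : Finset ι}
    (hS : S.Nonempty) (hd : S.card ≤ d) {β : ι → ℝ} (hβ : ∀ j ∈ S, b ≤ β j) :
    b ^ ((d : ℝ) / (d + 1)) ≤ ∑ j ∈ S, b / √(β j) + ∏ j ∈ S, √(β j) := by
  have hm : 0 < S.card := hS.card_pos
  have hd0 : (0 : ℝ) < d := by exact_mod_cast lt_of_lt_of_le hm hd
  rcases hb.eq_or_lt with rfl | hb0
  · rw [Real.zero_rpow (by positivity)]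
    exact add_nonneg (sum_nonneg fun _ _ => by positivity) (prod_nonneg fun _ _ => by positivity)
  have hβ0 : ∀ j ∈ S, 0 < √(β j) := fun j hj => Real.sqrt_pos.mpr (hb0.trans_le (hβ j hj))
  set X := b ^ ((S.card : ℝ) / (S.card + 1)) with hX
  have hX0 : 0 < X := Real.rpow_pos_of_pos hb0 _
  have hXpow : X ^ (S.card + 1) = b ^ S.card := by
    rw [hX, ← Real.rpow_natCast, ← Real.rpow_mul hb, ← Real.rpow_natCast]
    congr 1
    push_cast
    field_simp
  have hle : b ^ ((d : ℝ) / (d + 1)) ≤ X := by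
    refine Real.rpow_le_rpow_of_exponent_ge hb0 hb1 ?_
    rw [div_le_div_iff₀ (by positivity) (by positivity)]
    have : (S.card : ℝ) ≤ d := by exact_mod_cast hd
    nlinarith
  refine hle.trans ?_
  -- The `S.card + 1` summands multiply to `b ^ S.card = X ^ (S.card + 1)`, so they cannot all be at
  -- most `X` with the last one strictly smaller.
  by_contra! hlt
  have hy : ∀ j ∈ S, b / √(β j) ≤ X := fun j hj =>
    (single_le_sum (f := fun j => b / √(β j)) (fun i hi => (div_pos hb0 (hβ0 i hi)).le) hj).trans
      ((le_add_of_nonneg_right (prod_nonneg fun i hi => (hβ0 i hi).le)).trans hlt.le)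
  have hP : ∏ j ∈ S, √(β j) < X :=
    (le_add_of_nonneg_left (sum_nonneg fun i hi => (div_pos hb0 (hβ0 i hi)).le)).trans_lt hlt
  have h1 : b ^ S.card = (∏ j ∈ S, b / √(β j)) * ∏ j ∈ S, √(β j) := by
    rw [← prod_mul_distrib, ← prod_const]
    exact prod_congr rfl fun j hj => (div_mul_cancel₀ _ (hβ0 j hj).ne').symm
  have h2 : ∏ j ∈ S, b / √(β j) ≤ X ^ S.card := by
    rw [← prod_const]
    exact prod_le_prod (fun i hi => (div_pos hb0 (hβ0 i hi)).le) hy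
  have h3 : b ^ S.card < X ^ (S.card + 1) := by
    rw [h1, pow_succ]
    exact mul_lt_mul' h2 hP (prod_nonneg fun i hi => (hβ0 i hi).le) (by positivity)
  exact absurd hXpow h3.ne'

section Cube

variable {ι : Type*} [Fintype ι] [DecidableEq ι]

/-- For `|z j| ≤ 1` the product weight is the law of independent signs with means `z j`. The
identity itself is algebraic and factors over coordinates. -/
theorem sum_walsh_mul_prod (S : Finset ι) (z : ι → ℝ) :
    ∑ x : ι → ℤˣ, walsh S x * ∏ j, (1 + ((x j : ℤ) : ℝ) * z j) / 2 = ∏ j ∈ S, z j := by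
  have h : ∀ x : ι → ℤˣ, walsh S x * ∏ j, (1 + ((x j : ℤ) : ℝ) * z j) / 2 =
      ∏ j, (if j ∈ S then ((x j : ℤ) : ℝ) else 1) * ((1 + ((x j : ℤ) : ℝ) * z j) / 2) := by
    intro x
    rw [prod_mul_distrib, walsh, prod_ite_mem, univ_inter]
  have h2 := (prod_univ_sum (fun _ : ι => (univ : Finset ℤˣ)) fun j (u : ℤˣ) =>
    (if j ∈ S then ((u : ℤ) : ℝ) else 1) * ((1 + ((u : ℤ) : ℝ) * z j) / 2)).symm
  rw [Fintype.piFinset_univ] at h2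
  rw [sum_congr rfl fun x _ => h x, h2, show ∏ j ∈ S, z j = ∏ j, if j ∈ S then z j else 1 by simp]
  refine prod_congr rfl fun j _ => ?_
  rw [show (univ : Finset ℤˣ) = {1, -1} from rfl, sum_pair (by decide)]
  split_ifs <;> simp <;> ring

/-- The multi-affine extension to the solid cube has the same maximum. -/
theorem abs_multiaffine_le {c : Finset ι → ℝ} {M : ℝ} (hM : ∀ x, |walshSum c x| ≤ M)
    {z : ι → ℝ} (hz : ∀ j, |z j| ≤ 1) : |∑ S, c S * ∏ j ∈ S, z j| ≤ M := by
  have hw : ∀ x : ι → ℤˣ, 0 ≤ ∏ j, (1 + ((x j : ℤ) : ℝ) * z j) / 2 := by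
    intro x
    refine prod_nonneg fun j _ => ?_
    have := abs_le.mp (hz j)
    rcases Int.units_eq_one_or (x j) with h | h <;> simp [h] <;> linarith
  have h1 : ∑ x : ι → ℤˣ, ∏ j, (1 + ((x j : ℤ) : ℝ) * z j) / 2 = 1 := by
    simpa [walsh] using sum_walsh_mul_prod ∅ z
  have h2 : ∑ S, c S * ∏ j ∈ S, z j =
      ∑ x : ι → ℤˣ, walshSum c x * ∏ j, (1 + ((x j : ℤ) : ℝ) * z j) / 2 := by
    simp only [walshSum, sum_mul, mul_assoc]
    rw [sum_comm]
    refine sum_congr rfl fun S _ => ?_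
    rw [← mul_sum, sum_walsh_mul_prod]
  calc |∑ S, c S * ∏ j ∈ S, z j|
      ≤ ∑ x : ι → ℤˣ, |walshSum c x * ∏ j, (1 + ((x j : ℤ) : ℝ) * z j) / 2| := by
        rw [h2]; exact abs_sum_le_sum_abs _ _
    _ ≤ ∑ x : ι → ℤˣ, M * ∏ j, (1 + ((x j : ℤ) : ℝ) * z j) / 2 := by
        refine sum_le_sum fun x _ => ?_
        rw [abs_mul, abs_of_nonneg (hw x)]
        exact mul_le_mul_of_nonneg_right (hM x) (hw x)
    _ = M := by rw [← mul_sum, h1, mul_one]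

/-- The part of a function on the cube that is odd in the `j`-th variable. -/
def oddPart (c : Finset ι → ℝ) (j : ι) : Finset ι → ℝ := fun S => if j ∈ S then c S else 0

/-- Multiplying the coordinates in `J` by `s` gives a polynomial in `s` of degree at most `d`,
bounded by `M` on `[-1, 1]`. Its derivative at 1 weights each `S` by the size of `S ∩ J`, which is
the sum of the odd parts over `J`. Taking `J` to be the indices of each sign in turn costs the
factor 2. -/
theorem exists_sum_abs_oddPart_le (d : ℕ) : ∃ C : ℝ, 0 ≤ C ∧
    ∀ {ι : Type} [Fintype ι] [DecidableEq ι] (c : Finset ι → ℝ) (M : ℝ),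
      (∀ S, d < S.card → c S = 0) → (∀ x, |walshSum c x| ≤ M) →
      ∀ x, ∑ j, |walshSum (oddPart c j) x| ≤ C * M := by
  obtain ⟨C, hC, h⟩ := exists_bound_derivative_eval_one d
  refine ⟨2 * C, by positivity, ?_⟩
  intro ι _ _ c M hc hM x
  have key : ∀ J : Finset ι, |∑ j ∈ J, walshSum (oddPart c j) x| ≤ C * M := by
    intro J
    have hq := h (∑ S, Polynomial.C (c S * walsh S x) * Polynomial.X ^ (S ∩ J).card) M ?_ ?_
    · convert hq using 2
      simp only [Polynomial.derivative_sum, Polynomial.eval_finsetSum, walshSum, oddPart]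
      rw [sum_comm]
      refine sum_congr rfl fun S _ => ?_
      simp only [Polynomial.derivative_C_mul, Polynomial.derivative_X_pow, Polynomial.eval_mul,
        Polynomial.eval_C, Polynomial.eval_pow, Polynomial.eval_X, one_pow, mul_one]
      rw [← sum_mul, sum_ite_mem, sum_const, nsmul_eq_mul, inter_comm J S]
      ring
    · refine Polynomial.natDegree_sum_le_of_forall_le _ _ fun S _ => ?_
      by_cases hS : d < S.card
      · simp [hc S hS]
      · exact (Polynomial.natDegree_C_mul_X_pow_le _ _).trans
          ((card_le_card inter_subset_left).trans (by omega))
    · intro s hs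
      have := abs_multiaffine_le hM (z := fun j => ((x j : ℤ) : ℝ) * if j ∈ J then s else 1) ?_
      · convert this using 2
        rw [Polynomial.eval_finsetSum]
        refine sum_congr rfl fun S _ => ?_
        rw [prod_mul_distrib, prod_ite_mem, prod_const]
        rw [Polynomial.eval_mul, Polynomial.eval_C, Polynomial.eval_pow, Polynomial.eval_X, walsh,
          mul_assoc]
      · intro j
        rcases Int.units_eq_one_or (x j) with h | h <;> split_ifs <;> simp [h, hs]
  rw [← sum_filter_add_sum_filter_not univ fun j => 0 ≤ walshSum (oddPart c j) x, mul_assoc,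
    two_mul]
  refine add_le_add ?_ ?_
  · refine le_trans (le_of_eq ?_) ((le_abs_self _).trans
      (key (univ.filter fun j => 0 ≤ walshSum (oddPart c j) x)))
    exact sum_congr rfl fun j hj => abs_of_nonneg (mem_filter.mp hj).2
  · refine le_trans (le_of_eq ?_) ((neg_le_abs _).trans
      (key (univ.filter fun j => ¬ 0 ≤ walshSum (oddPart c j) x)))
    rw [← sum_neg_distrib]
    exact sum_congr rfl fun j hj => abs_of_neg (not_le.mp (mem_filter.mp hj).2)

/-- Bound on the sum of the `ℓ²`-norms of the coefficients of the discrete derivatives. -/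
theorem exists_sum_sqrt_sum_sq_le (d : ℕ) : ∃ C : ℝ, 0 ≤ C ∧
    ∀ {ι : Type} [Fintype ι] [DecidableEq ι] (c : Finset ι → ℝ) (M : ℝ),
      (∀ S, d < S.card → c S = 0) → (∀ x, |walshSum c x| ≤ M) →
      ∑ j, √(∑ S, if j ∈ S then c S ^ 2 else 0) ≤ C * M := by
  obtain ⟨C, hC, h⟩ := exists_sum_abs_oddPart_le d
  refine ⟨3 ^ d * C, by positivity, ?_⟩
  intro ι _ _ c M hc hM
  -- Parseval turns the coefficient norm into an `L²` norm, and `3^d` is the square root of the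
  -- `9^d` in the moment comparison. The pointwise bound on odd parts is then averaged over `x`.
  have h1 : ∀ j, √(∑ S, if j ∈ S then c S ^ 2 else 0) ≤
      3 ^ d * 𝔼 x, |walshSum (oddPart c j) x| := by
    intro j
    have e : ∑ S, (if j ∈ S then c S ^ 2 else 0) = 𝔼 x, walshSum (oddPart c j) x ^ 2 := by
      rw [expect_walshSum_sq]
      refine sum_congr rfl fun S _ => ?_
      simp only [oddPart]
      split_ifs <;> simp
    rw [e]
    refine Real.sqrt_le_iff.mpr ⟨mul_nonneg (by positivity)
      (expect_nonneg fun _ _ => abs_nonneg _), ?_⟩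
    rw [mul_pow, ← pow_mul, mul_comm d, pow_mul, show (3 : ℝ) ^ 2 = 9 by norm_num]
    refine expect_walshSum_sq_le fun S hS => ?_
    simp [oddPart, hc S hS]
  refine (sum_le_sum fun j _ => h1 j).trans ?_
  rw [← mul_sum, ← expect_sum_comm, mul_assoc]
  exact mul_le_mul_of_nonneg_left (expect_le univ_nonempty fun x _ => h c M hc hM x)
    (by positivity)

/-- Blei's inequality, in a normalized form for set-indexed families. -/
theorem sum_rpow_le_of_sum_sqrt_le_one {d : ℕ} {b : Finset ι → ℝ} (hb : ∀ S, 0 ≤ b S)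
    (hd : ∀ S, d < S.card → b S = 0) (h1 : ∑ j, √(∑ S, if j ∈ S then b S else 0) ≤ 1)
    (hd1 : 1 ≤ d) :
    ∑ S ∈ univ.filter (fun S : Finset ι => S.Nonempty), b S ^ ((d : ℝ) / (d + 1)) ≤
      1 + Real.exp 1 := by
  set β : ι → ℝ := fun j => ∑ S, if j ∈ S then b S else 0 with hβ
  have hβb : ∀ S, ∀ j ∈ S, b S ≤ β j := by
    intro S j hj
    have := single_le_sum (f := fun S => if j ∈ S then b S else 0) (s := univ)
      (fun T _ => by split_ifs <;> simp [hb]) (mem_univ S)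
    simpa [hj] using this
  have hp : ∀ S ∈ univ.filter (fun S : Finset ι => S.Nonempty), b S ^ ((d : ℝ) / (d + 1)) ≤
      ∑ j ∈ S, b S / √(β j) + ∏ j ∈ S, √(β j) := by
    intro S hS
    have hS' : S.Nonempty := (mem_filter.mp hS).2
    by_cases hdS : d < S.card
    · rw [hd S hdS, Real.zero_rpow (by positivity)]
      exact add_nonneg (sum_nonneg fun _ _ => by positivity)
        (prod_nonneg fun _ _ => by positivity)
    · refine rpow_le_sum_add_prod (hb S) ?_ hS' (not_lt.mp hdS) (hβb S)
      obtain ⟨j, hj⟩ := hS'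
      have : √(β j) ≤ 1 :=
        (single_le_sum (f := fun j => √(β j)) (fun _ _ => by positivity) (mem_univ j)).trans h1
      exact (hβb S j hj).trans (Real.sqrt_le_one.mp this)
  refine (sum_le_sum hp).trans ?_
  refine (sum_le_univ_sum_of_nonneg fun S => add_nonneg (sum_nonneg fun _ _ =>
    div_nonneg (hb S) (by positivity)) (prod_nonneg fun _ _ => by positivity)).trans ?_
  rw [sum_add_distrib]
  refine add_le_add ?_ ?_
  -- Exchanging the sums leaves `β j / √(β j) = √(β j)`, also when `β j = 0`, where division by zero
  -- gives 0.
  · have : ∑ S : Finset ι, ∑ j ∈ S, b S / √(β j) = ∑ j, √(β j) := by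
      have e : ∀ S : Finset ι, ∑ j ∈ S, b S / √(β j) = ∑ j, (if j ∈ S then b S else 0) / √(β j) := by
        intro S
        simp [ite_div, sum_ite_mem]
      rw [sum_congr rfl fun S _ => e S, sum_comm]
      refine sum_congr rfl fun j _ => ?_
      rw [← sum_div]
      exact Real.div_sqrt
    rw [this]
    exact h1
  · have : ∑ S : Finset ι, ∏ j ∈ S, √(β j) = ∏ j, (1 + √(β j)) := by
      rw [prod_one_add, powerset_univ]
    rw [this]
    refine (Real.prod_one_add_le_exp_sum _ fun _ => by positivity).trans ?_
    exact Real.exp_le_exp.mpr h1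

end Cube

/-! ### The cube Bohnenblust–Hille inequality and its best constant. -/

theorem norm_cubePoly_le_iSup {𝕜 : Type*} [RCLike 𝕜] {n : ℕ} (c : Finset (Fin n) → 𝕜)
    (x : Fin n → ℤˣ) : ‖cubePoly c x‖ ≤ ⨆ y : Fin n → ℤˣ, ‖cubePoly c y‖ :=
  le_ciSup (f := fun y => ‖cubePoly c y‖) (Set.finite_range _).bddAbove x

theorem bhNorm_le_of_sum_le {ι 𝕜 : Type*} [Fintype ι] [RCLike 𝕜] {d : ℕ} (hd : 1 ≤ d)
    {c : ι → 𝕜} {M B : ℝ} (hM : 0 ≤ M) (hB : 0 ≤ B)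
    (h : ∑ i, ‖c i‖ ^ (2 * (d : ℝ) / ((d : ℝ) + 1)) ≤ B * M ^ (2 * (d : ℝ) / ((d : ℝ) + 1))) :
    bhNorm d c ≤ B ^ (((d : ℝ) + 1) / (2 * (d : ℝ))) * M := by
  have hd0 : (0 : ℝ) < d := by exact_mod_cast hd
  refine (Real.rpow_le_rpow (sum_nonneg fun _ _ => by positivity) h (by positivity)).trans ?_
  rw [Real.mul_rpow hB (by positivity), ← Real.rpow_mul hM,
    show 2 * (d : ℝ) / ((d : ℝ) + 1) * (((d : ℝ) + 1) / (2 * (d : ℝ))) = 1 by field_simp,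
    Real.rpow_one]

theorem abs_rpow_two_mul_div (d : ℕ) (t : ℝ) :
    |t| ^ (2 * (d : ℝ) / ((d : ℝ) + 1)) = (t ^ 2) ^ ((d : ℝ) / ((d : ℝ) + 1)) := by
  rw [← sq_abs, ← Real.rpow_natCast |t| 2, ← Real.rpow_mul (abs_nonneg t)]
  congr 1
  push_cast
  ring

/-- The Bohnenblust--Hille inequality on the Boolean cube, for real functions. -/
theorem exists_isCubeBHConst_real {d : ℕ} (hd : 1 ≤ d) : ∃ C, IsCubeBHConst ℝ d C := by
  obtain ⟨C, hC, h⟩ := exists_sum_sqrt_sum_sq_le d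
  have hd0 : (0 : ℝ) < d := by exact_mod_cast hd
  have hB : (0 : ℝ) ≤ 2 + Real.exp 1 := by positivity
  -- In `2 + e`, the empty set accounts for 1 and the nonempty sets for `1 + e`. Using `C + 1` makes
  -- the normalizer `M` positive and at least `N`, as the empty coefficient requires.
  refine ⟨(2 + Real.exp 1) ^ (((d : ℝ) + 1) / (2 * (d : ℝ))) * (C + 1), fun n _ c hc => ?_⟩
  set N : ℝ := ⨆ x : Fin n → ℤˣ, ‖cubePoly c x‖ with hN
  have hx : ∀ x, |walshSum c x| ≤ N := fun x => norm_cubePoly_le_iSup c x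
  have hN0 : 0 ≤ N := (abs_nonneg _).trans (hx 1)
  rw [mul_assoc]
  refine bhNorm_le_of_sum_le hd (by positivity) hB ?_
  have hp : 0 < 2 * (d : ℝ) / ((d : ℝ) + 1) := by positivity
  rcases hN0.eq_or_lt with h0 | h0
  · have hw : ∀ x, walshSum c x = 0 := fun x =>
      abs_eq_zero.mp (le_antisymm (h0 ▸ hx x) (abs_nonneg _))
    have hs := expect_walshSum_sq c
    simp only [hw, ne_eq, OfNat.ofNat_ne_zero, not_false_eq_true, zero_pow, expect_const_zero] at hs
    have hc0 : ∀ S, c S = 0 := fun S => by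
      have := (sum_eq_zero_iff_of_nonneg fun S _ => sq_nonneg (c S)).mp hs.symm S (mem_univ S)
      exact pow_eq_zero_iff two_ne_zero |>.mp this
    simp only [hc0, norm_zero, Real.zero_rpow hp.ne', sum_const_zero]
    positivity
  set M := (C + 1) * N with hM
  have hM0 : 0 < M := by positivity
  set b : Finset (Fin n) → ℝ := fun S => (c S / M) ^ 2 with hb
  have hb1 : ∑ j, √(∑ S, if j ∈ S then b S else 0) ≤ 1 := by
    have e : ∀ j, √(∑ S, if j ∈ S then b S else 0) =
        √(∑ S, if j ∈ S then c S ^ 2 else 0) / M := by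
      intro j
      have : ∑ S, (if j ∈ S then b S else 0) = (∑ S, if j ∈ S then c S ^ 2 else 0) / M ^ 2 := by
        rw [sum_div]
        refine sum_congr rfl fun S _ => ?_
        split_ifs <;> simp [hb, div_pow]
      rw [this, Real.sqrt_div (sum_nonneg fun S _ => by split_ifs <;> positivity),
        Real.sqrt_sq hM0.le]
    rw [sum_congr rfl fun j _ => e j, ← sum_div, div_le_one hM0]
    exact (h c N hc hx).trans (by rw [hM]; nlinarith)
  have hbd : ∀ S, d < S.card → b S = 0 := fun S hS => by simp [hb, hc S hS]
  have key := sum_rpow_le_of_sum_sqrt_le_one (fun S => sq_nonneg _) hbd hb1 hd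
  have hempty : b ∅ ^ ((d : ℝ) / (d + 1)) ≤ 1 := by
    refine Real.rpow_le_one (sq_nonneg _) ?_ (by positivity)
    have h1 : |c ∅| ≤ N := by
      rw [← expect_walshSum c]
      exact (abs_expect_le _ _).trans (expect_le univ_nonempty fun x _ => hx x)
    rw [hb, sq_le_one_iff_abs_le_one, abs_div, abs_of_pos hM0, div_le_one hM0]
    exact h1.trans (by rw [hM]; nlinarith)
  have hsum : ∑ S, b S ^ ((d : ℝ) / (d + 1)) ≤ 2 + Real.exp 1 := by
    rw [← sum_filter_add_sum_filter_not univ fun S : Finset (Fin n) => S.Nonempty]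
    have : univ.filter (fun S : Finset (Fin n) => ¬ S.Nonempty) = {∅} := by
      ext S; simp
    rw [this, sum_singleton]
    linarith
  calc ∑ S, ‖c S‖ ^ (2 * (d : ℝ) / ((d : ℝ) + 1))
      = ∑ S, b S ^ ((d : ℝ) / (d + 1)) * M ^ (2 * (d : ℝ) / ((d : ℝ) + 1)) := by
        refine sum_congr rfl fun S _ => ?_
        rw [hb, ← abs_rpow_two_mul_div, ← Real.mul_rpow (abs_nonneg _) hM0.le, abs_div,
          abs_of_pos hM0, div_mul_cancel₀ _ hM0.ne', Real.norm_eq_abs]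
    _ ≤ _ := by rw [← sum_mul]; gcongr

theorem one_le_two_mul_div_add_one {d : ℕ} (hd : 1 ≤ d) : 1 ≤ 2 * (d : ℝ) / ((d : ℝ) + 1) := by
  rw [le_div_iff₀ (by positivity)]
  have : (1 : ℝ) ≤ d := by exact_mod_cast hd
  linarith

theorem cubePoly_re {n : ℕ} (c : Finset (Fin n) → ℂ) (x : Fin n → ℤˣ) :
    cubePoly (fun S => (c S).re) x = (cubePoly c x).re := by
  simp only [cubePoly, Complex.re_sum]
  refine sum_congr rfl fun S _ => ?_
  have : (∏ j ∈ S, (((x j : ℤˣ) : ℤ) : ℂ)) = ((∏ j ∈ S, (((x j : ℤˣ) : ℤ) : ℝ) : ℝ) : ℂ) := by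
    push_cast; rfl
  rw [this, Complex.re_mul_ofReal]

theorem cubePoly_im {n : ℕ} (c : Finset (Fin n) → ℂ) (x : Fin n → ℤˣ) :
    cubePoly (fun S => (c S).im) x = (cubePoly c x).im := by
  simp only [cubePoly, Complex.im_sum]
  refine sum_congr rfl fun S _ => ?_
  have : (∏ j ∈ S, (((x j : ℤˣ) : ℤ) : ℂ)) = ((∏ j ∈ S, (((x j : ℤˣ) : ℤ) : ℝ) : ℝ) : ℂ) := by
    push_cast; rfl
  rw [this, Complex.im_mul_ofReal]

/-- The Bohnenblust--Hille inequality on the Boolean cube, for complex functions. -/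
theorem exists_isCubeBHConst_complex {d : ℕ} (hd : 1 ≤ d) : ∃ C, IsCubeBHConst ℂ d C := by
  obtain ⟨C, h⟩ := exists_isCubeBHConst_real hd
  refine ⟨2 * |C|, fun n hn c hc => ?_⟩
  have hp := one_le_two_mul_div_add_one hd
  have hsup : ∀ a : Finset (Fin n) → ℝ, (∀ x, |cubePoly a x| ≤ ‖cubePoly c x‖) →
      (∀ S, d < S.card → a S = 0) →
      bhNorm d a ≤ |C| * ⨆ x : Fin n → ℤˣ, ‖cubePoly c x‖ := by
    intro a ha had
    refine (h n hn a had).trans (mul_le_mul (le_abs_self C)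
      (ciSup_mono (Set.finite_range _).bddAbove ha) ?_ (abs_nonneg C))
    exact Real.iSup_nonneg fun x => norm_nonneg _
  have hre := hsup (fun S => (c S).re)
    (fun x => by rw [cubePoly_re]; exact Complex.abs_re_le_norm _) fun S hS => by simp [hc S hS]
  have him := hsup (fun S => (c S).im)
    (fun x => by rw [cubePoly_im]; exact Complex.abs_im_le_norm _) fun S hS => by simp [hc S hS]
  -- Minkowski's inequality; the exponent `2d/(d+1)` is at least 1 because `d ≥ 1`.
  have hadd : bhNorm d c ≤ bhNorm d (fun S => (c S).re) + bhNorm d (fun S => (c S).im) := by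
    have hmink := Real.Lp_add_le_of_nonneg (univ : Finset (Finset (Fin n))) hp
      (fun S _ => abs_nonneg (c S).re) (fun S _ => abs_nonneg (c S).im)
    rw [one_div_div] at hmink
    refine le_trans ?_ hmink
    refine Real.rpow_le_rpow (sum_nonneg fun _ _ => by positivity)
      (sum_le_sum fun S _ => ?_) (by positivity)
    exact Real.rpow_le_rpow (norm_nonneg _) (Complex.norm_le_abs_re_add_abs_im _) (by positivity)
  linarith

/-- Tested on the constant function 1. This makes the best constant positive. -/
theorem one_le_of_isCubeBHConst {𝕜 : Type*} [RCLike 𝕜] {d : ℕ} (hd : 1 ≤ d) {C : ℝ}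
    (h : IsCubeBHConst 𝕜 d C) : 1 ≤ C := by
  have h1 := h 1 le_rfl (fun S => if S = ∅ then 1 else 0) fun S hS => by
    have : S ≠ ∅ := by rintro rfl; simp at hS
    simp [this]
  have hp : 0 < 2 * (d : ℝ) / ((d : ℝ) + 1) := by
    have := one_le_two_mul_div_add_one hd
    linarith
  have e1 : ∀ x : Fin 1 → ℤˣ,
      cubePoly (fun S : Finset (Fin 1) => if S = ∅ then (1 : 𝕜) else 0) x = 1 := by
    intro x
    simp [cubePoly]
  have e2 : bhNorm d (fun S : Finset (Fin 1) => if S = ∅ then (1 : 𝕜) else 0) = 1 := by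
    have : ∀ S : Finset (Fin 1), ‖(if S = ∅ then (1 : 𝕜) else 0)‖ ^
        (2 * (d : ℝ) / ((d : ℝ) + 1)) = if S = ∅ then 1 else 0 := by
      intro S
      split_ifs <;> simp [Real.zero_rpow hp.ne']
    rw [bhNorm, sum_congr rfl fun S _ => this S]
    simp
  simpa [e1, e2] using h1

/-- The best constant is admissible as soon as some constant is. -/
theorem isCubeBHConst_cubeBH {𝕜 : Type*} [RCLike 𝕜] {d : ℕ} (h : ∃ C, IsCubeBHConst 𝕜 d C) :
    IsCubeBHConst 𝕜 d (cubeBH 𝕜 d) := by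
  intro n hn c hc
  set N : ℝ := ⨆ x : Fin n → ℤˣ, ‖cubePoly c x‖ with hN
  have hN0 : 0 ≤ N := Real.iSup_nonneg fun x => norm_nonneg _
  rcases hN0.eq_or_lt with h0 | h0
  · obtain ⟨C, hC⟩ := h
    have := hC n hn c hc
    rw [← hN, ← h0, mul_zero] at this
    rwa [← h0, mul_zero]
  · rw [← div_le_iff₀ h0]
    exact le_csInf h fun C hC => (div_le_iff₀ h0).mpr (hC n hn c hc)

theorem one_le_cubeBH {𝕜 : Type*} [RCLike 𝕜] {d : ℕ} (hd : 1 ≤ d)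
    (h : ∃ C, IsCubeBHConst 𝕜 d C) : 1 ≤ cubeBH 𝕜 d :=
  le_csInf h fun _ hC => one_le_of_isCubeBHConst hd hC

/-- The cube Bohnenblust--Hille inequality for a family of coefficients whose monomials are
indexed by distinct subsets of an arbitrary finite set. -/
theorem IsCubeBHConst.bhNorm_le {𝕜 : Type*} [RCLike 𝕜] {d : ℕ} (hd : 1 ≤ d) {C : ℝ}
    (hC : IsCubeBHConst 𝕜 d C) {ι κ : Type*} [Fintype ι] [DecidableEq ι] [Nonempty ι] [Fintype κ]
    {g : κ → Finset ι} (hg : Function.Injective g) {a : κ → 𝕜}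
    (ha : ∀ k, d < (g k).card → a k = 0) {M : ℝ}
    (hM : ∀ x : ι → ℤˣ, ‖∑ k, a k * ∏ j ∈ g k, (((x j : ℤˣ) : ℤ) : 𝕜)‖ ≤ M) :
    bhNorm d a ≤ C * M := by
  classical
  have hp : 0 < 2 * (d : ℝ) / ((d : ℝ) + 1) := by
    have := one_le_two_mul_div_add_one hd
    linarith
  set e := Fintype.equivFin ι
  set G : κ → Finset (Fin (Fintype.card ι)) := fun k => (g k).map e.toEmbedding with hG
  have hGinj : Function.Injective G := fun k l hkl => hg (map_injective _ hkl)
  -- Sets that index no monomial get coefficient 0 and contribute nothing to the norm, the exponent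
  -- being positive.
  set c : Finset (Fin (Fintype.card ι)) → 𝕜 := Function.extend G a 0 with hc
  have hcG : ∀ k, c (G k) = a k := fun k => hGinj.extend_apply a 0 k
  have hc0 : ∀ S, S ∉ Set.range G → c S = 0 := fun S hS => by
    rw [hc, Function.extend_apply' _ _ _ hS]; rfl
  have hnorm : bhNorm d a = bhNorm d c := by
    rw [bhNorm, bhNorm]
    congr 1
    refine Fintype.sum_of_injective G hGinj _ _ (fun S hS => ?_) fun k => by rw [hcG]
    rw [hc0 S hS, norm_zero, Real.zero_rpow hp.ne']
  have hpoly : ∀ y : Fin (Fintype.card ι) → ℤˣ,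
      cubePoly c y = ∑ k, a k * ∏ j ∈ g k, (((y (e j) : ℤˣ) : ℤ) : 𝕜) := by
    intro y
    refine (Fintype.sum_of_injective G hGinj _ _ (fun S hS => ?_) fun k => ?_).symm
    · rw [hc0 S hS, zero_mul]
    · rw [hcG, hG, prod_map]
      rfl
  have hC0 : 0 ≤ C := zero_le_one.trans (one_le_of_isCubeBHConst hd hC)
  rw [hnorm]
  refine (hC _ Fintype.card_pos c fun S hS => ?_).trans
    (mul_le_mul_of_nonneg_left (ciSup_le fun y => ?_) hC0)
  · by_cases hSG : S ∈ Set.range G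
    · obtain ⟨k, rfl⟩ := hSG
      rw [hcG]
      exact ha k (by simpa [hG] using hS)
    · exact hc0 S hSG
  · rw [hpoly]
    exact hM fun j => y (e j)

/-! ### Tensor products, positivity and trace duality. -/

theorem tensorMatrix_mul {n K : ℕ} (M N : Fin n → Matrix (Fin K) (Fin K) ℂ) :
    tensorMatrix M * tensorMatrix N = tensorMatrix fun j => M j * N j := by
  ext a b
  simp only [tensorMatrix, Matrix.mul_apply, Matrix.of_apply, ← prod_mul_distrib]
  rw [prod_univ_sum, Fintype.piFinset_univ]

theorem trace_tensorMatrix {n K : ℕ} (M : Fin n → Matrix (Fin K) (Fin K) ℂ) :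
    (tensorMatrix M).trace = ∏ j, (M j).trace := by
  simp only [tensorMatrix, Matrix.trace, Matrix.diag, Matrix.of_apply]
  rw [prod_univ_sum, Fintype.piFinset_univ]

theorem tensorMatrix_conjTranspose {n K : ℕ} (M : Fin n → Matrix (Fin K) (Fin K) ℂ) :
    (tensorMatrix M).conjTranspose = tensorMatrix fun j => (M j).conjTranspose := by
  ext a b
  simp [tensorMatrix, Matrix.conjTranspose_apply]

/-- Factor each site and tensor the factors; the form `Bᴴ B` is what the trace estimate consumes. -/
theorem exists_tensorMatrix_eq_conjTranspose_mul_self {n K : ℕ}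
    {M : Fin n → Matrix (Fin K) (Fin K) ℂ} (hM : ∀ j, (M j).PosSemidef) :
    ∃ B : QuditOp n K, tensorMatrix M = B.conjTranspose * B := by
  have h : ∀ j, ∃ B : Matrix (Fin K) (Fin K) ℂ, M j = B.conjTranspose * B := fun j =>
    CStarAlgebra.nonneg_iff_eq_star_mul_self.mp (hM j).nonneg
  choose B hB using h
  refine ⟨tensorMatrix B, ?_⟩
  rw [tensorMatrix_conjTranspose, tensorMatrix_mul]
  exact congrArg tensorMatrix (funext hB)

theorem norm_dotProduct_mulVec_le {n K : ℕ} (A : QuditOp n K) (v : (Fin n → Fin K) → ℂ) :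
    ‖star v ⬝ᵥ A.mulVec v‖ ≤ opNorm A * ∑ i, ‖v i‖ ^ 2 := by
  set w : EuclideanSpace ℂ (Fin n → Fin K) := WithLp.toLp 2 v with hw
  have h1 : star v ⬝ᵥ A.mulVec v = inner ℂ w (Matrix.toEuclideanCLM (𝕜 := ℂ) A w) := by
    rw [EuclideanSpace.inner_eq_star_dotProduct, dotProduct_comm]
    rfl
  have h2 : ∑ i, ‖v i‖ ^ 2 = ‖w‖ ^ 2 := by
    rw [EuclideanSpace.norm_sq_eq]
  rw [h1, h2]
  calc _ ≤ ‖w‖ * ‖Matrix.toEuclideanCLM (𝕜 := ℂ) A w‖ := norm_inner_le_norm _ _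
    _ ≤ ‖w‖ * (opNorm A * ‖w‖) := by
      gcongr
      exact ContinuousLinearMap.le_opNorm _ _
    _ = _ := by ring

/-- Duality between the trace norm and the operator norm, for positive matrices. -/
theorem norm_trace_mul_conjTranspose_mul_self_le {n K : ℕ} (A B : QuditOp n K) :
    ‖((B.conjTranspose * B) * A).trace‖ ≤ opNorm A * ‖(B.conjTranspose * B).trace‖ := by
  -- By cyclicity the trace is a sum of quadratic forms of `A` at the conjugated rows of `B`, whose
  -- squared norms add up to the trace of `Bᴴ B`.
  have h1 : ((B.conjTranspose * B) * A).trace =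
      ∑ i, star (fun k => star (B i k)) ⬝ᵥ A.mulVec fun k => star (B i k) := by
    rw [mul_assoc, Matrix.trace_mul_comm]
    simp only [Matrix.trace, Matrix.diag, Matrix.mul_assoc]
    refine sum_congr rfl fun i _ => ?_
    rw [Matrix.mul_apply]
    simp [dotProduct, Matrix.mulVec, Matrix.mul_apply, Matrix.conjTranspose_apply]
  have h2 : (B.conjTranspose * B).trace = ((∑ i, ∑ k, ‖star (B i k)‖ ^ 2 : ℝ) : ℂ) := by
    rw [Matrix.trace_mul_comm]
    simp only [Matrix.trace, Matrix.diag, Matrix.mul_apply, Matrix.conjTranspose_apply, norm_star]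
    push_cast
    refine sum_congr rfl fun i _ => sum_congr rfl fun k _ => ?_
    exact Complex.mul_conj' _
  rw [h1, h2, Complex.norm_real, Real.norm_of_nonneg (by positivity), mul_sum]
  exact (norm_sum_le _ _).trans (sum_le_sum fun i _ => norm_dotProduct_mulVec_le A _)

/-! ### One-site states built from signed Gell-Mann sums. -/

theorem gmMatrix_isHermitian {K : ℕ} (a : GMIndex K) :
    (gmMatrix K a).conjTranspose = gmMatrix K a := by
  rcases a with _ | ((p | p) | r)
  · simp [gmMatrix]
  · simp [gmMatrix, gmSym, Matrix.conjTranspose_single, add_comm]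
  · simp [gmMatrix, gmAnti, Matrix.conjTranspose_single, add_comm]
  · simp only [gmMatrix, gmDiag_eq, Matrix.conjTranspose_smul, Matrix.diagonal_conjTranspose]
    congr 1
    · simp
    · congr 1
      ext i
      simp only [Pi.star_apply]
      split_ifs <;> simp

/-- This is the rank-one matrix `v vᴴ` with `v = e_j + u e_k`. -/
theorem posSemidef_pair {K : ℕ} (j k : Fin K) {u : ℂ} (hu : u * star u = 1) :
    (Matrix.single j j (1 : ℂ) + Matrix.single k k 1 +
      (Matrix.single j k (star u) + Matrix.single k j u)).PosSemidef := by
  have h := Matrix.posSemidef_vecMulVec_self_star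
    fun i : Fin K => (if j = i then (1 : ℂ) else 0) + if k = i then u else 0
  convert h using 1
  ext a b
  simp only [Matrix.add_apply, Matrix.single_apply, Matrix.vecMulVec_apply, Pi.star_apply,
    star_add, apply_ite star, star_one, star_zero, ite_and]
  split_ifs <;> first | ring1 | linear_combination -hu

/-- The off-diagonal half of a resolution of the identity. -/
theorem sum_pairLT_single (K : ℕ) :
    ∑ p : PairLT K, (Matrix.single p.1.1 p.1.1 (1 : ℂ) + Matrix.single p.1.2 p.1.2 1) =
      ((K : ℂ) - 1) • (1 : Matrix (Fin K) (Fin K) ℂ) := by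
  ext a b
  by_cases hab : a = b
  · subst hab
    have h1 : ∀ i, (Matrix.single i i (1 : ℂ)) a a = if i = a then 1 else 0 := by
      intro i; simp [Matrix.single_apply]
    simp only [Matrix.sum_apply, Matrix.add_apply, h1, Matrix.smul_apply, Matrix.one_apply_eq,
      smul_eq_mul, mul_one]
    have e1 : ∑ p : PairLT K, ((if p.1.1 = a then (1 : ℂ) else 0) + if p.1.2 = a then 1 else 0) =
        ∑ p : Fin K × Fin K, if p.1 < p.2 then
          (if p.1 = a then (1 : ℂ) else 0) + (if p.2 = a then 1 else 0) else 0 := by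
      rw [← sum_filter]
      exact (sum_subtype _ (fun p => by simp) (fun p : Fin K × Fin K =>
        (if p.1 = a then (1 : ℂ) else 0) + if p.2 = a then 1 else 0)).symm
    have e2 : ∀ p : Fin K × Fin K, (if p.1 < p.2 then
          (if p.1 = a then (1 : ℂ) else 0) + (if p.2 = a then 1 else 0) else 0) =
        (if p.1 = a then (if a < p.2 then 1 else 0) else 0) +
          if p.2 = a then (if p.1 < a then 1 else 0) else 0 := by
      intro p
      split_ifs <;> first | omega | simp
    rw [e1, sum_congr rfl fun p _ => e2 p, sum_add_distrib, Fintype.sum_prod_type,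
      Fintype.sum_prod_type_right]
    simp only [sum_ite_irrel, sum_const_zero, sum_ite_eq', mem_univ, if_true]
    -- The index `a` forms one pair with every other index, hence lies in `K - 1` pairs.
    have e3 : ∀ k : Fin K, ((if a < k then (1 : ℂ) else 0) + if k < a then 1 else 0) =
        1 - if k = a then 1 else 0 := by
      intro k
      split_ifs <;> first | omega | simp
    rw [← sum_add_distrib, sum_congr rfl fun k _ => e3 k, sum_sub_distrib]
    simp
  · have h1 : ∀ i, (Matrix.single i i (1 : ℂ)) a b = 0 := by
      intro i
      simp only [Matrix.single_apply]
      rw [if_neg]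
      rintro ⟨rfl, rfl⟩
      exact hab rfl
    simp [Matrix.sum_apply, h1, hab]

/-- The coefficient of the non-identity Gell-Mann matrices in the states `gmState`. -/
noncomputable def gmScale (K : ℕ) : ℝ := (3 * ((K : ℝ) - 1) * √((K : ℝ) / 2))⁻¹

/-- These are the absolute diagonal entries at position `i` of the unnormalized diagonal matrices:
`N - i` ones and a single entry `i`, the total being independent of `i`. -/
theorem sum_diag_weight (N i : ℕ) : ∑ r ∈ range N,
    ((if i ≤ r then (1 : ℝ) else 0) + ((r : ℝ) + 1) * if i = r + 1 then 1 else 0) =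
      if i ≤ N then (N : ℝ) else 0 := by
  induction N with
  | zero => simp
  | succ N ih =>
    rw [sum_range_succ, ih]
    push_cast
    split_ifs <;> first | omega | simp

/-- The normalizing factors are at most `√(K/2)` because `m² + m ≥ 2`, and the remaining weights add
up to `K - 1`. -/
theorem abs_sum_gmDiag_le {K : ℕ} (x : Fin (K - 1) → ℤˣ) (i : Fin K) :
    |∑ r : Fin (K - 1), ((x r : ℤ) : ℝ) *
      (√((K : ℝ) / (((r : ℕ) + 1 : ℝ) ^ 2 + ((r : ℕ) + 1 : ℝ))) *
        ((if (i : ℕ) ≤ r then (1 : ℝ) else 0) -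
          ((r : ℕ) + 1 : ℝ) * if (i : ℕ) = r + 1 then (1 : ℝ) else 0))| ≤
      √((K : ℝ) / 2) * ((K : ℝ) - 1) := by
  have hi := i.isLt
  have hw := sum_diag_weight (K - 1) i
  rw [if_pos (by omega), Nat.cast_sub (by omega), Nat.cast_one] at hw
  rw [← hw, ← Fin.sum_univ_eq_sum_range (fun r => (if (i : ℕ) ≤ r then (1 : ℝ) else 0) +
    ((r : ℝ) + 1) * if (i : ℕ) = r + 1 then 1 else 0), mul_sum]
  refine (abs_sum_le_sum_abs _ _).trans (sum_le_sum fun r _ => ?_)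
  have hx : |((x r : ℤ) : ℝ)| = 1 := by
    rcases Int.units_eq_one_or (x r) with h | h <;> simp [h]
  rw [abs_mul, abs_mul, hx, one_mul, abs_of_nonneg (Real.sqrt_nonneg _)]
  refine mul_le_mul (Real.sqrt_le_sqrt ?_) ?_ (abs_nonneg _) (Real.sqrt_nonneg _)
  · have : (0 : ℝ) ≤ (r : ℕ) := Nat.cast_nonneg _
    exact div_le_div_of_nonneg_left (by positivity) (by norm_num) (by nlinarith)
  · refine (abs_sub _ _).trans (le_of_eq ?_)
    rw [abs_of_nonneg (by split_ifs <;> simp), abs_of_nonneg (by split_ifs <;> positivity)]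

theorem gmScale_mul_sqrt {K : ℕ} (hK : 2 ≤ K) :
    (gmScale K : ℂ) * ((√((K : ℝ) / 2) : ℝ) : ℂ) = ((3 * ((K : ℝ) - 1))⁻¹ : ℝ) := by
  have h2 : (2 : ℝ) ≤ K := by exact_mod_cast hK
  have hs : √((K : ℝ) / 2) ≠ 0 := (Real.sqrt_pos.mpr (by linarith)).ne'
  rw [← Complex.ofReal_mul, gmScale, mul_inv, mul_assoc, inv_mul_cancel₀ hs, mul_one]

/-- Rank-one pieces summed over all pairs have diagonal part `(K - 1) I`; dividing by `3 (K - 1)`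
leaves one third of the identity. -/
theorem posSemidef_of_pairs {K : ℕ} (hK : 2 ≤ K) {u : PairLT K → ℂ}
    (hu : ∀ p, u p * star (u p) = 1) :
    ((3 : ℂ)⁻¹ • (1 : Matrix (Fin K) (Fin K) ℂ) + (((3 * ((K : ℝ) - 1))⁻¹ : ℝ) : ℂ) •
      ∑ p : PairLT K, (Matrix.single p.1.1 p.1.2 (star (u p)) +
        Matrix.single p.1.2 p.1.1 (u p))).PosSemidef := by
  have h2 : (2 : ℝ) ≤ K := by exact_mod_cast hK
  have hK1 : (K : ℂ) - 1 ≠ 0 := by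
    have : ((K : ℝ) - 1) ≠ 0 := by linarith
    exact_mod_cast this
  have h : (∑ p : PairLT K, (Matrix.single p.1.1 p.1.1 (1 : ℂ) + Matrix.single p.1.2 p.1.2 1 +
      (Matrix.single p.1.1 p.1.2 (star (u p)) + Matrix.single p.1.2 p.1.1 (u p)))).PosSemidef :=
    Matrix.posSemidef_sum _ fun p _ => posSemidef_pair _ _ (hu p)
  rw [sum_add_distrib, sum_pairLT_single] at h
  have h' := h.smul (a := (((3 * ((K : ℝ) - 1))⁻¹ : ℝ) : ℂ))
    (Complex.zero_le_real.mpr (inv_nonneg.mpr (by linarith)))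
  rw [smul_add, smul_smul] at h'
  convert h' using 3
  push_cast
  field_simp

/-- The matrix `I + c ∑ₐ xₐ Mₐ` is positive for all choices of signs. -/
theorem posSemidef_one_add_smul_sum {K : ℕ} (hK : 2 ≤ K)
    (x : (PairLT K ⊕ PairLT K) ⊕ Fin (K - 1) → ℤˣ) :
    (1 + (gmScale K : ℂ) • ∑ a, ((x a : ℤ) : ℂ) • gmMatrix K (some a)).PosSemidef := by
  have h2 : (2 : ℝ) ≤ K := by exact_mod_cast hK
  have hx : ∀ a, ((x a : ℤ) : ℂ) * ((x a : ℤ) : ℂ) = 1 := by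
    intro a
    rcases Int.units_eq_one_or (x a) with h | h <;> simp [h]
  have hA := posSemidef_of_pairs hK (u := fun p => ((x (Sum.inl (Sum.inl p)) : ℤ) : ℂ))
    fun p => by simpa using hx _
  -- The phase `u = ± i` turns the pair matrices into the antisymmetric generators.
  have hB := posSemidef_of_pairs hK
    (u := fun p => ((x (Sum.inl (Sum.inr p)) : ℤ) : ℂ) * Complex.I) fun p => by
      simp only [star_mul', Complex.star_def, Complex.conj_I, map_intCast]
      linear_combination -Complex.I ^ 2 * hx (Sum.inl (Sum.inr p)) - Complex.I_sq
  set δ : Fin K → ℝ := fun i => ∑ r : Fin (K - 1), ((x (Sum.inr r) : ℤ) : ℝ) *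
      (√((K : ℝ) / (((r : ℕ) + 1 : ℝ) ^ 2 + ((r : ℕ) + 1 : ℝ))) *
        ((if (i : ℕ) ≤ r then (1 : ℝ) else 0) -
          ((r : ℕ) + 1 : ℝ) * if (i : ℕ) = r + 1 then (1 : ℝ) else 0)) with hδ
  have hC : (Matrix.diagonal fun i => ((3⁻¹ + gmScale K * δ i : ℝ) : ℂ)).PosSemidef := by
    refine Matrix.posSemidef_diagonal_iff.mpr fun i => Complex.zero_le_real.mpr ?_
    have h1 := abs_sum_gmDiag_le (fun r => x (Sum.inr r)) i
    have hs : 0 < √((K : ℝ) / 2) := Real.sqrt_pos.mpr (by linarith)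
    have hc : 0 < gmScale K := inv_pos.mpr (mul_pos (by linarith) hs)
    have h3 : gmScale K * (√((K : ℝ) / 2) * ((K : ℝ) - 1)) = 3⁻¹ := by
      have : (K : ℝ) - 1 ≠ 0 := by linarith
      rw [gmScale]
      field_simp
    have h4 : gmScale K * -(√((K : ℝ) / 2) * ((K : ℝ) - 1)) ≤ gmScale K * δ i :=
      mul_le_mul_of_nonneg_left (abs_le.mp h1).1 hc.le
    linarith
  convert (hA.add hB).add hC using 1
  have eC : (Matrix.diagonal fun i => ((3⁻¹ + gmScale K * δ i : ℝ) : ℂ)) =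
      (3 : ℂ)⁻¹ • (1 : Matrix (Fin K) (Fin K) ℂ) +
        (gmScale K : ℂ) • ∑ r, ((x (Sum.inr r) : ℤ) : ℂ) • gmDiag K r := by
    ext i j
    by_cases hij : i = j
    · subst hij
      simp [gmDiag_eq, Matrix.sum_apply, hδ]
      exact Or.inl (sum_congr rfl fun r _ => by split_ifs <;> simp)
    · simp [gmDiag_eq, Matrix.sum_apply, hij]
  rw [eC, Fintype.sum_sum_type, Fintype.sum_sum_type, ← gmScale_mul_sqrt hK]
  have eA : ((√((K : ℝ) / 2) : ℝ) : ℂ) •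
      ∑ p, (Matrix.single p.1.1 p.1.2 (star ((x (Sum.inl (Sum.inl p)) : ℤ) : ℂ)) +
        Matrix.single p.1.2 p.1.1 ((x (Sum.inl (Sum.inl p)) : ℤ) : ℂ)) =
      ∑ p, ((x (Sum.inl (Sum.inl p)) : ℤ) : ℂ) • gmMatrix K (some (Sum.inl (Sum.inl p))) := by
    rw [smul_sum]
    refine sum_congr rfl fun p _ => ?_
    simp only [gmMatrix, gmSym, smul_add, Matrix.smul_single, smul_eq_mul]
    congr 2 <;> simp [mul_comm]
  have eB : ((√((K : ℝ) / 2) : ℝ) : ℂ) •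
      ∑ p, (Matrix.single p.1.1 p.1.2 (star (((x (Sum.inl (Sum.inr p)) : ℤ) : ℂ) * Complex.I)) +
        Matrix.single p.1.2 p.1.1 (((x (Sum.inl (Sum.inr p)) : ℤ) : ℂ) * Complex.I)) =
      ∑ p, ((x (Sum.inl (Sum.inr p)) : ℤ) : ℂ) • gmMatrix K (some (Sum.inl (Sum.inr p))) := by
    rw [smul_sum]
    refine sum_congr rfl fun p _ => ?_
    simp only [gmMatrix, gmAnti, smul_add, Matrix.smul_single, smul_eq_mul]
    congr 2 <;> simp <;> ring
  rw [mul_smul, mul_smul, eA, eB]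
  have e1 : (1 : Matrix (Fin K) (Fin K) ℂ) = (3 : ℂ)⁻¹ • 1 + (3 : ℂ)⁻¹ • 1 + (3 : ℂ)⁻¹ • 1 := by
    rw [← add_smul, ← add_smul]
    norm_num
  nth_rewrite 1 [e1]
  simp only [smul_add, gmMatrix]
  abel

/-- The one-site states `K⁻¹ (I + c ∑ₐ xₐ Mₐ)`. -/
noncomputable def gmState {K : ℕ} (x : (PairLT K ⊕ PairLT K) ⊕ Fin (K - 1) → ℤˣ) :
    Matrix (Fin K) (Fin K) ℂ :=
  (K : ℂ)⁻¹ • (1 + (gmScale K : ℂ) • ∑ a, ((x a : ℤ) : ℂ) • gmMatrix K (some a))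

theorem gmState_posSemidef {K : ℕ} (hK : 2 ≤ K)
    (x : (PairLT K ⊕ PairLT K) ⊕ Fin (K - 1) → ℤˣ) : (gmState x).PosSemidef := by
  refine (posSemidef_one_add_smul_sum hK x).smul ?_
  simp

theorem trace_gmMatrix_mul_gmState {K : ℕ} (hK : 2 ≤ K)
    (x : (PairLT K ⊕ PairLT K) ⊕ Fin (K - 1) → ℤˣ) (a : GMIndex K) :
    ((gmMatrix K a).conjTranspose * gmState x).trace =
      a.elim 1 fun b => (gmScale K : ℂ) * ((x b : ℤ) : ℂ) := by
  have hK0 : (K : ℂ) ≠ 0 := by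
    have : K ≠ 0 := by omega
    exact_mod_cast this
  have h1 : (1 : Matrix (Fin K) (Fin K) ℂ) = gmMatrix K none := rfl
  rw [gmState, h1]
  simp only [Matrix.mul_smul, Matrix.mul_add, Matrix.mul_sum, Matrix.trace_smul, Matrix.trace_add,
    Matrix.trace_sum, gm_orth, smul_eq_mul]
  rcases a with _ | b
  · simp [hK0]
  · simp
    field_simp

/-! ### From qudit operators to polynomials on the cube. -/

/-- The positions and the labels of the non-identity factors of `M_α`. -/
def gmSupport {n K : ℕ} (α : Fin n → GMIndex K) :
    Finset (Fin n × ((PairLT K ⊕ PairLT K) ⊕ Fin (K - 1))) :=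
  univ.filter fun p => α p.1 = some p.2

/-- Distinct `α` thus give distinct Walsh monomials, so each coefficient of `A` appears alone as a
cube coefficient. -/
theorem gmSupport_injective {n K : ℕ} :
    Function.Injective (gmSupport : (Fin n → GMIndex K) → _) := by
  intro α β h
  have h' : ∀ j b, α j = some b ↔ β j = some b := by
    intro j b
    have := Finset.ext_iff.mp h (j, b)
    simpa [gmSupport] using this
  funext j
  exact Option.ext fun b => h' j b

theorem prod_gmSupport {n K : ℕ} {R : Type*} [CommMonoid R] (α : Fin n → GMIndex K)
    (φ : Fin n × ((PairLT K ⊕ PairLT K) ⊕ Fin (K - 1)) → R) :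
    ∏ p ∈ gmSupport α, φ p = ∏ j, (α j).elim 1 fun b => φ (j, b) := by
  rw [gmSupport, prod_filter, Fintype.prod_prod_type]
  refine prod_congr rfl fun j _ => ?_
  dsimp only
  rcases Option.eq_none_or_eq_some (α j) with h | ⟨b, h⟩ <;> simp only [h, reduceCtorEq, if_false, prod_const_one, Option.elim_none,
    Option.some.injEq, prod_ite_eq, mem_univ, if_true, Option.elim_some]

theorem card_gmSupport {n K : ℕ} (α : Fin n → GMIndex K) : (gmSupport α).card = gmWeight α := by
  rw [gmSupport, gmWeight, card_filter, card_filter, Fintype.sum_prod_type]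
  refine sum_congr rfl fun j _ => ?_
  dsimp only
  rcases Option.eq_none_or_eq_some (α j) with h | ⟨b, h⟩ <;> simp only [h, reduceCtorEq, if_false, sum_const_zero, ne_eq, not_true,
    not_false_eq_true, Option.some.injEq, sum_ite_eq, mem_univ, if_true]

theorem trace_tensorMatrix_gmState_mul {n K : ℕ} (hK : 2 ≤ K) (A : QuditOp n K)
    (x : Fin n × ((PairLT K ⊕ PairLT K) ⊕ Fin (K - 1)) → ℤˣ) :
    (tensorMatrix (fun j => gmState fun b => x (j, b)) * A).trace =
      ∑ α, gmCoeff A α * (gmScale K : ℂ) ^ gmWeight α *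
        ∏ p ∈ gmSupport α, ((x p : ℤ) : ℂ) := by
  have hA := (eq_sum_gmTensor_iff (by omega : K ≠ 0) A (gmCoeff A)).mpr rfl
  conv_lhs => rw [hA]
  simp only [Matrix.mul_sum, Matrix.trace_sum, Matrix.mul_smul, Matrix.trace_smul, smul_eq_mul]
  refine sum_congr rfl fun α _ => ?_
  rw [mul_assoc, ← card_gmSupport, ← prod_const, ← prod_mul_distrib, prod_gmSupport,
    Matrix.trace_mul_comm, gmTensor, tensorMatrix_mul, trace_tensorMatrix]
  congr 1
  refine prod_congr rfl fun j _ => ?_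
  rw [← trace_gmMatrix_mul_gmState hK, gmMatrix_isHermitian]

theorem norm_sum_gmCoeff_le {n K : ℕ} (hK : 2 ≤ K) (A : QuditOp n K)
    (x : Fin n × ((PairLT K ⊕ PairLT K) ⊕ Fin (K - 1)) → ℤˣ) :
    ‖∑ α, gmCoeff A α * (gmScale K : ℂ) ^ gmWeight α * ∏ p ∈ gmSupport α, ((x p : ℤ) : ℂ)‖ ≤
      opNorm A := by
  rw [← trace_tensorMatrix_gmState_mul hK]
  obtain ⟨B, hB⟩ := exists_tensorMatrix_eq_conjTranspose_mul_self
    fun j => gmState_posSemidef hK fun b => x (j, b)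
  have h1 : (tensorMatrix (fun j => gmState fun b => x (j, b))).trace = 1 := by
    rw [trace_tensorMatrix]
    refine prod_eq_one fun j _ => ?_
    simpa [gmMatrix] using trace_gmMatrix_mul_gmState hK (fun b => x (j, b)) none
  have h2 := norm_trace_mul_conjTranspose_mul_self_le A B
  rwa [← hB, h1, norm_one, mul_one] at h2

theorem gmCoeff_im_eq_zero {n K : ℕ} {A : QuditOp n K} (hA : A.IsHermitian)
    (α : Fin n → GMIndex K) : (gmCoeff A α).im = 0 := by
  have hM : (gmTensor α).conjTranspose = gmTensor α := by
    rw [gmTensor, tensorMatrix_conjTranspose]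
    exact congrArg tensorMatrix (funext fun j => gmMatrix_isHermitian _)
  rw [← Complex.conj_eq_iff_im, gmCoeff, map_mul, map_inv₀, map_pow, Complex.conj_natCast]
  congr 1
  rw [starRingEnd_apply, ← Matrix.trace_conjTranspose, Matrix.conjTranspose_mul,
    Matrix.conjTranspose_conjTranspose, hA.eq, hM, Matrix.trace_mul_comm]

theorem gmScale_pos {K : ℕ} (hK : 2 ≤ K) : 0 < gmScale K := by
  have h2 : (2 : ℝ) ≤ K := by exact_mod_cast hK
  exact inv_pos.mpr (mul_pos (by linarith) (Real.sqrt_pos.mpr (by linarith)))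

/-- Since `K ≥ 2`, `√(K/2) ≤ K/2`; this is where the constant `3/2 (K² - K)` comes from. -/
theorem one_le_mul_gmScale {K : ℕ} (hK : 2 ≤ K) :
    1 ≤ 3 / 2 * ((K : ℝ) ^ 2 - K) * gmScale K := by
  have h2 : (2 : ℝ) ≤ K := by exact_mod_cast hK
  have hs : √((K : ℝ) / 2) ≤ K / 2 := Real.sqrt_le_iff.mpr ⟨by linarith, by nlinarith⟩
  rw [gmScale, ← div_eq_mul_inv,
    one_le_div (mul_pos (by linarith) (Real.sqrt_pos.mpr (by linarith)))]
  nlinarith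

theorem one_le_three_halves_mul {K : ℕ} (hK : 2 ≤ K) : 1 ≤ 3 / 2 * ((K : ℝ) ^ 2 - K) := by
  have h2 : (2 : ℝ) ≤ K := by exact_mod_cast hK
  nlinarith

/-- Transfer of the cube inequality to qudits, given a family of scalars with the same absolute
values as the Gell-Mann coefficients. -/
theorem bhNorm_gmCoeff_le {𝕜 : Type*} [RCLike 𝕜] {n K d : ℕ} (hK : 2 ≤ K) (hd : 1 ≤ d)
    (hn : 1 ≤ n) {C : ℝ} (hC : IsCubeBHConst 𝕜 d C) {A : QuditOp n K} (hA : GMDegreeLE d A)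
    {a : (Fin n → GMIndex K) → 𝕜} (ha : ∀ α, ‖a α‖ = ‖gmCoeff A α‖)
    (hsum : ∀ x : Fin n × ((PairLT K ⊕ PairLT K) ⊕ Fin (K - 1)) → ℤˣ,
      ‖∑ α, a α * (gmScale K : 𝕜) ^ gmWeight α * ∏ p ∈ gmSupport α, ((x p : ℤ) : 𝕜)‖ ≤
        opNorm A) :
    bhNorm d (gmCoeff A) ≤ (3 / 2 * ((K : ℝ) ^ 2 - K)) ^ d * C * opNorm A := by
  have hc := gmScale_pos hK
  have hD := one_le_three_halves_mul hK
  have hDc := one_le_mul_gmScale hK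
  set D : ℝ := 3 / 2 * ((K : ℝ) ^ 2 - K) with hDdef
  have : Nonempty (Fin n × ((PairLT K ⊕ PairLT K) ⊕ Fin (K - 1))) :=
    ⟨(⟨0, hn⟩, Sum.inr ⟨0, by omega⟩)⟩
  have ha0 : ∀ α, d < gmWeight α → a α = 0 := fun α hα => by
    rw [← norm_eq_zero, ha, hA α hα, norm_zero]
  have key := hC.bhNorm_le hd gmSupport_injective
    (a := fun α => a α * (gmScale K : 𝕜) ^ gmWeight α)
    (fun α hα => by rw [card_gmSupport] at hα; simp [ha0 α hα]) hsum
  -- Each non-identity factor costs at most `D`, as `D * gmScale K ≥ 1`; at most `d` of them occur,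
  -- and `D ≥ 1` permits the uniform factor `D ^ d`.
  have hle : ∀ α, ‖gmCoeff A α‖ ≤ D ^ d * ‖a α * (gmScale K : 𝕜) ^ gmWeight α‖ := by
    intro α
    rw [norm_mul, norm_pow, RCLike.norm_ofReal, abs_of_pos hc, ha]
    by_cases hα : d < gmWeight α
    · simp [hA α hα]
    · have h1 : 1 ≤ D ^ d * gmScale K ^ gmWeight α := by
        calc 1 ≤ (D * gmScale K) ^ gmWeight α := one_le_pow₀ hDc
          _ = D ^ gmWeight α * gmScale K ^ gmWeight α := mul_pow _ _ _
          _ ≤ D ^ d * gmScale K ^ gmWeight α := by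
            gcongr
            omega
      nlinarith [norm_nonneg (gmCoeff A α)]
  have hp := one_le_two_mul_div_add_one hd
  have hd0 : (0 : ℝ) < d := by exact_mod_cast hd
  have hfin : bhNorm d (gmCoeff A) ≤
      D ^ d * bhNorm d fun α => a α * (gmScale K : 𝕜) ^ gmWeight α := by
    set p := 2 * (d : ℝ) / ((d : ℝ) + 1) with hpdef
    have hpp : p * (((d : ℝ) + 1) / (2 * (d : ℝ))) = 1 := by rw [hpdef]; field_simp
    have h0 : 0 ≤ ∑ α, ‖a α * (gmScale K : 𝕜) ^ gmWeight α‖ ^ p :=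
      sum_nonneg fun _ _ => by positivity
    calc bhNorm d (gmCoeff A)
        ≤ ((D ^ d) ^ p * ∑ α, ‖a α * (gmScale K : 𝕜) ^ gmWeight α‖ ^ p) ^
            (((d : ℝ) + 1) / (2 * (d : ℝ))) := by
          refine Real.rpow_le_rpow (sum_nonneg fun _ _ => by positivity) ?_ (by positivity)
          rw [mul_sum]
          refine sum_le_sum fun α _ => ?_
          rw [← Real.mul_rpow (by positivity) (norm_nonneg _)]
          exact Real.rpow_le_rpow (norm_nonneg _) (hle α) (by positivity)
      _ = _ := by
          rw [Real.mul_rpow (by positivity) h0, ← Real.rpow_mul (by positivity), hpp,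
            Real.rpow_one]
          rfl
  calc _ ≤ _ := hfin
    _ ≤ D ^ d * (C * opNorm A) := by gcongr
    _ = _ := by ring

end QuditBH

theorem theorem1p3 (K d : ℕ) (hK : 2 ≤ K) (hd : 1 ≤ d) :
    (∃ C : ℝ, 0 < C ∧
      (∀ n : ℕ, 1 ≤ n → ∀ A : QuditBH.QuditOp n K, A.IsHermitian → QuditBH.GMDegreeLE d A →
        QuditBH.bhNorm d (QuditBH.gmCoeff A) ≤ C * QuditBH.opNorm A) ∧
      C ≤ (3 / 2 * ((K : ℝ) ^ 2 - (K : ℝ))) ^ d * QuditBH.cubeBH ℝ d) ∧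
    (∃ C : ℝ, 0 < C ∧
      (∀ n : ℕ, 1 ≤ n → ∀ A : QuditBH.QuditOp n K, QuditBH.GMDegreeLE d A →
        QuditBH.bhNorm d (QuditBH.gmCoeff A) ≤ C * QuditBH.opNorm A) ∧
      C ≤ (3 / 2 * ((K : ℝ) ^ 2 - (K : ℝ))) ^ d * QuditBH.cubeBH ℂ d) := by
  have hD : (0 : ℝ) < (3 / 2 * ((K : ℝ) ^ 2 - (K : ℝ))) ^ d :=
    pow_pos (zero_lt_one.trans_le (QuditBH.one_le_three_halves_mul hK)) d
  have hR := QuditBH.exists_isCubeBHConst_real hd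
  have hC := QuditBH.exists_isCubeBHConst_complex hd
  -- The constants are the claimed bounds themselves. Admissibility of the infimum rests on `hR` and
  -- `hC`: the infimum of an empty set of reals would be 0 by default.
  refine ⟨⟨_, mul_pos hD (zero_lt_one.trans_le (QuditBH.one_le_cubeBH hd hR)),
    fun n hn A hA hAd => ?_, le_rfl⟩,
    ⟨_, mul_pos hD (zero_lt_one.trans_le (QuditBH.one_le_cubeBH hd hC)),
    fun n hn A hAd => ?_, le_rfl⟩⟩
  · have hre : ∀ α, (((QuditBH.gmCoeff A α).re : ℝ) : ℂ) = QuditBH.gmCoeff A α := fun α =>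
      Complex.ext rfl (QuditBH.gmCoeff_im_eq_zero hA α).symm
    refine QuditBH.bhNorm_gmCoeff_le hK hd hn (QuditBH.isCubeBHConst_cubeBH hR) hAd
      (a := fun α => (QuditBH.gmCoeff A α).re) (fun α => ?_) fun x => ?_
    · rw [← Complex.norm_real, hre]
    · refine le_trans (le_of_eq ?_) (QuditBH.norm_sum_gmCoeff_le hK A x)
      rw [← Complex.norm_real]
      congr 1
      push_cast
      exact Finset.sum_congr rfl fun α _ => by rw [hre]; rfl
  · exact QuditBH.bhNorm_gmCoeff_le hK hd hn (QuditBH.isCubeBHConst_cubeBH hC) hAd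
      (fun _ => rfl) fun x => QuditBH.norm_sum_gmCoeff_le hK A x
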